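/- **Conventions.** For positive integers $l,m$ let $(l,m)$ be their greatest common divisor, and let $\langle l,m\rangle$ be $1$ if $(l,m)=1$ and the least common prime divisor of $l$ and $m$ otherwise. For an integer $r>1$, an $r$-coloring (Fox coloring) of a link diagram assigns to each arc of the diagram an element (a color) of $\mathbb{Z}/r$ so that at each crossing the sum of the colors of the two under-arcs minus twice the color of the over-arc is $0$. It is trivial if all arcs get the same color. For a link $K$ that has non-trivial $r$-colorings, $\mathrm{mincol}_r K$ is the minimum, over all diagrams $D$ of $K$ and all non-trivial $r$-colorings of $D$, of the number of distinct colors assigned to the arcs of $D$. Let $T(2,n)$ denote the torus link of type $(2,n)$, that is, the closure of the $2$-braid $\sigma_1^n$. **Theorem.** Let $n$ and $r$ be positive integers with $(n,r)>1$. Then $T(2,n)$ has non-trivial $r$-colorings, and: - if $\langle n,r\rangle\in\{2,3\}$, then $\mathrm{mincol}_r T(2,n)=\langle n,r\rangle$; - if $\langle n,r\rangle=5$, then $\mathrm{mincol}_r T(2,n)=4$; - if $\langle n,r\rangle=2k+1$ for some integer $k>2$, then $3<\mathrm{mincol}_r T(2,n)\le k+2$. -/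

import Mathlib

/-!
# Link diagrams, Fox colorings and the minimum number of colors

Unoriented link diagrams in the plane are presented as *sliced diagrams*: after a planar isotopy
that puts it in general position with respect to the height function, a diagram is cut by
horizontal lines into slices, read from top to bottom, each of which contains vertical strands and
exactly one of: a local maximum, a local minimum, a crossing.  Links are sliced diagrams modulo
planar isotopy and the Reidemeister moves.
-/

namespace FoxColoring

/-- The elementary pieces of a sliced link diagram:
* `cap`: a local maximum (`∩`);
* `cup`: a local minimum (`∪`);
* `pos`: a crossing (the braid generator `σ₁`) whose over-strand runs from the top right to the
  bottom left, and whose under-strand runs from the top left to the bottom right;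
* `neg`: a crossing (`σ₁⁻¹`) whose over-strand runs from the top left to the bottom right, and
  whose under-strand runs from the top right to the bottom left. -/
inductive Piece : Type
  | cap
  | cup
  | pos
  | neg

/-- The number of strands entering a piece from above. -/
def Piece.ins : Piece → ℕ
  | .cap => 0
  | .cup => 2
  | .pos => 2
  | .neg => 2

/-- The number of strands leaving a piece below. -/
def Piece.outs : Piece → ℕ
  | .cap => 2
  | .cup => 0
  | .pos => 2
  | .neg => 2

/-- A slice: one elementary piece, with `left` vertical strands on its left (and any number of
vertical strands on its right). -/
structure Slice : Type where
  piece : Piece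
  left : ℕ

/-- `Fits w m n`: the slices of `w`, stacked from top to bottom, form a tangle diagram with `m`
strands at the top and `n` strands at the bottom. -/
def Fits : List Slice → ℕ → ℕ → Prop
  | [], m, n => m = n
  | s :: w, m, n => s.left + s.piece.ins ≤ m ∧ Fits w (m - s.piece.ins + s.piece.outs) n

/-- A (sliced, unoriented) link diagram in the plane. -/
structure Diagram : Type where
  word : List Slice
  closed : Fits word 0 0

/-- The local modifications of sliced tangle diagrams.  Each is applied to a group of adjacent
strands, with `i` strands on the left.  The first group consists of planar isotopies, the second
one of the Reidemeister moves of types I, II, III. -/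
inductive LocalMove : List Slice → List Slice → Prop
  /-- Straightening a strand (cancelling a maximum against a minimum). -/
  | zigzag_right (i : ℕ) : LocalMove [⟨.cap, i + 1⟩, ⟨.cup, i⟩] []
  | zigzag_left (i : ℕ) : LocalMove [⟨.cap, i⟩, ⟨.cup, i + 1⟩] []
  /-- Exchanging the heights of a piece `p` and of a piece `q` on the right of it, with `j`
  strands between the two. -/
  | exchange (p q : Piece) (i j : ℕ) :
      LocalMove [⟨q, i + p.ins + j⟩, ⟨p, i⟩] [⟨p, i⟩, ⟨q, i + p.outs + j⟩]
  /-- Moving a maximum, or a minimum, of one strand of a crossing through that crossing. -/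
  | slide_cap_pos (i : ℕ) :
      LocalMove [⟨.cap, i⟩, ⟨.pos, i + 1⟩] [⟨.cap, i + 1⟩, ⟨.neg, i⟩]
  | slide_cap_neg (i : ℕ) :
      LocalMove [⟨.cap, i⟩, ⟨.neg, i + 1⟩] [⟨.cap, i + 1⟩, ⟨.pos, i⟩]
  | slide_cup_pos (i : ℕ) :
      LocalMove [⟨.pos, i + 1⟩, ⟨.cup, i⟩] [⟨.neg, i⟩, ⟨.cup, i + 1⟩]
  | slide_cup_neg (i : ℕ) :
      LocalMove [⟨.neg, i + 1⟩, ⟨.cup, i⟩] [⟨.pos, i⟩, ⟨.cup, i + 1⟩]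
  /-- Type I: removing a kink. -/
  | reidemeister1_cap_pos (i : ℕ) : LocalMove [⟨.cap, i⟩, ⟨.pos, i⟩] [⟨.cap, i⟩]
  | reidemeister1_cap_neg (i : ℕ) : LocalMove [⟨.cap, i⟩, ⟨.neg, i⟩] [⟨.cap, i⟩]
  | reidemeister1_cup_pos (i : ℕ) : LocalMove [⟨.pos, i⟩, ⟨.cup, i⟩] [⟨.cup, i⟩]
  | reidemeister1_cup_neg (i : ℕ) : LocalMove [⟨.neg, i⟩, ⟨.cup, i⟩] [⟨.cup, i⟩]
  /-- Type II: separating two strands, one of which lies above the other. -/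
  | reidemeister2_pos (i : ℕ) : LocalMove [⟨.pos, i⟩, ⟨.neg, i⟩] []
  | reidemeister2_neg (i : ℕ) : LocalMove [⟨.neg, i⟩, ⟨.pos, i⟩] []
  /-- Type III: moving a strand across a crossing.  (The other versions of this move follow from
  this one and the moves of type II.) -/
  | reidemeister3 (i : ℕ) :
      LocalMove [⟨.pos, i⟩, ⟨.pos, i + 1⟩, ⟨.pos, i⟩] [⟨.pos, i + 1⟩, ⟨.pos, i⟩, ⟨.pos, i + 1⟩]

/-- `D'` arises from `D` by a local move.  (Both are diagrams, so that the strands which the move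
involves do exist.) -/
def Diagram.Move (D D' : Diagram) : Prop :=
  ∃ A B w w' : List Slice, LocalMove w w' ∧ D.word = A ++ w ++ B ∧ D'.word = A ++ w' ++ B

/-- A link (unoriented, up to ambient isotopy): a class of diagrams for the equivalence relation
generated by planar isotopy and Reidemeister moves. -/
def Link : Type := Quot Diagram.Move

/-- `D` is a diagram of the link `K`. -/
def Diagram.IsDiagramOf (D : Diagram) (K : Link) : Prop := Quot.mk Diagram.Move D = K

/-- The coloring rule of an elementary piece, relating the lists of the colors of its strands at
its top and at its bottom, from left to right.  At a crossing, the over-strand keeps its color `y`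
and the colors `x`, `x'` of the two under-arcs satisfy `x + x' - 2 y = 0`. -/
inductive PieceRule (r : ℕ) : Piece → List (ZMod r) → List (ZMod r) → Prop
  | cap (x : ZMod r) : PieceRule r .cap [] [x, x]
  | cup (x : ZMod r) : PieceRule r .cup [x, x] []
  | pos (x x' y : ZMod r) : x + x' - 2 * y = 0 → PieceRule r .pos [x, y] [y, x']
  | neg (x x' y : ZMod r) : x + x' - 2 * y = 0 → PieceRule r .neg [y, x] [x', y]

/-- The coloring rule of a slice: the vertical strands keep their colors, and the elementary piece
obeys its rule. -/
def SliceRule (r : ℕ) (s : Slice) (u v : List (ZMod r)) : Prop :=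
  ∃ a b t t' : List (ZMod r), a.length = s.left ∧ PieceRule r s.piece t t' ∧
    u = a ++ t ++ b ∧ v = a ++ t' ++ b

/-- An `r`-coloring (Fox coloring) of a diagram: a color in `ℤ/r` for each arc, such that at each
crossing the sum of the colors of the two under-arcs equals twice the color of the over-arc.
It is recorded by the lists `level j` of the colors (from left to right) of the arcs that cross
the horizontal line below the first `j` slices; there are no arcs above the first slice, and none
from the bottom of the last slice on.  The rules of the slices say that colors are constant along
arcs and that they satisfy the relation at each crossing. -/
structure Coloring (r : ℕ) (D : Diagram) : Type where
  level : ℕ → List (ZMod r)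
  top : level 0 = []
  rule : ∀ (j : ℕ) (hj : j < D.word.length), SliceRule r D.word[j] (level j) (level (j + 1))
  bottom : ∀ j : ℕ, D.word.length ≤ j → level j = []

/-- The set of the colors that a coloring assigns to the arcs (every arc crosses at least one of
the horizontal lines between consecutive slices). -/
def Coloring.colors {r : ℕ} {D : Diagram} (c : Coloring r D) : Set (ZMod r) :=
  {x | ∃ j : ℕ, x ∈ c.level j}

/-- A coloring is trivial if it assigns the same color to all arcs. -/
def Coloring.IsTrivial {r : ℕ} {D : Diagram} (c : Coloring r D) : Prop :=
  ∀ x ∈ c.colors, ∀ y ∈ c.colors, x = y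

/-- The minimum number of distinct colors of a non-trivial `r`-coloring of the diagram `D`
(and `⊤` if there is no such coloring). -/
noncomputable def minColors (r : ℕ) (D : Diagram) : ℕ∞ :=
  ⨅ (c : Coloring r D) (_ : ¬ c.IsTrivial), c.colors.encard

/-- The minimum number of colors of the link `K` mod `r`: the minimum of `minColors r D` over all
diagrams `D` of `K` (and `⊤` if there are no non-trivial `r`-colorings). -/
noncomputable def mincol (r : ℕ) (K : Link) : ℕ∞ :=
  ⨅ (D : Diagram) (_ : D.IsDiagramOf K), minColors r D

theorem fits_replicate_pos (n : ℕ) (w : List Slice) (h : Fits w 4 0) :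
    Fits (List.replicate n ⟨.pos, 0⟩ ++ w) 4 0 := by
  induction n with
  | zero => simpa using h
  | succ n ih => exact ⟨by decide, ih⟩

/-- The diagram of `T(2, n)` given by the closure of the 2-braid `σ₁ⁿ`: the two strands of the
braid are the strands at positions 0 and 1, and are closed up by two nested arcs on the right. -/
def torusDiagram (n : ℕ) : Diagram where
  word := ⟨.cap, 0⟩ :: ⟨.cap, 1⟩ :: (List.replicate n ⟨.pos, 0⟩ ++ [⟨.cup, 1⟩, ⟨.cup, 0⟩])
  closed := by
    have h : Fits [⟨.cup, 1⟩, ⟨.cup, 0⟩] 4 0 := ⟨by decide, by decide, rfl⟩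
    exact ⟨by decide, by decide, fits_replicate_pos n _ h⟩

/-- The torus link `T(2, n)`. -/
def torusLink (n : ℕ) : Link := Quot.mk Diagram.Move (torusDiagram n)

/-- `⟨l, m⟩`: it is `1` if `l` and `m` are coprime, and their least common prime divisor
otherwise. -/
noncomputable def leastCommonPrime (l m : ℕ) : ℕ :=
  if Nat.gcd l m = 1 then 1 else sInf {p : ℕ | p.Prime ∧ p ∣ l ∧ p ∣ m}

end FoxColoring

/-!
# The minimum number of colors of the torus links `T(2, n)`

Let `p` be the least common prime divisor of `n` and `r`.

*All diagrams at once.*  A Reidemeister move turns a coloring into a coloring that agrees with it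
away from the move, and the new colors are obtained from the old ones by the operation
`(x, y) ↦ 2 y - x`.  So the subquandle of `ℤ/r` generated by the colors is the same for the
corresponding colorings of any two diagrams of a link (`exists_tangleColoring_of_mk_eq`).  In the
standard diagram of `T(2, n)` all colors differ by `n`-torsion, hence they do so in every diagram
(`mul_sub_eq_zero`), and these differences have no torsion below `p` (`eq_zero_of_mul_eq_zero`).

*Lower bounds.*  Modulo `n + 1`, which is prime to `n`, the link has only trivial colorings.  So
the colors of a non-trivial coloring cannot be relabelled by elements of `ℤ/(n+1)`, not all equal,
in a way that respects the relations at the crossings (`relabel_const`).  If `p > 2` and each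
crossing has only one color, any relabelling does; so some crossing has three distinct colors
`x`, `x'`, `y` with `x + x' = 2 y` (`exists_nontrivial_relation`).  If there are no more colors and
`p > 3`, then this is the only relation, and `x ↦ 1`, `x' ↦ -1`, `y ↦ 0` is a relabelling
(`three_lt_encard`).

*Upper bounds.*  Let `d` be an element of order `p` in `ℤ/r`.  The standard diagram is colored by
the `p` multiples of `d`.  If `p = 2 k + 1`, the braid is cut into groups of `p` crossings, in which
the color pairs are `(0, d), (d, 2d), …, (2kd, 0), (0, d)`.  At the crossing
`((k-1)d, kd) → (kd, (k+1)d)` the over-strand, of color `kd`, is swung around the next `k`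
crossings and passes over the two strands below them (`isotopic_swungTwist`).  This reflects the
colors of these crossings by `x ↦ 2kd - x`, so that only `0, d, …, kd` and `2kd` are left
(`colorableIn_economicalTwist`).
-/

namespace FoxColoring

/-! ### Colorings of tangles -/

/-- `TangleColoring r w u v C`: the tangle diagram `w` has an `r`-coloring with the colors `u` at
its top and `v` at its bottom, whose set of colors is `C`. -/
def TangleColoring (r : ℕ) :
    List Slice → List (ZMod r) → List (ZMod r) → Set (ZMod r) → Prop
  | [], u, v, C => u = v ∧ C = {x | x ∈ u}
  | s :: w, u, v, C =>
      ∃ u' C', SliceRule r s u u' ∧ TangleColoring r w u' v C' ∧ C = {x | x ∈ u} ∪ C'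

/-- A set of colors is a subquandle if it contains the color `2 y - x` of an under-arc whenever it
contains the colors of the over-arc `y` and of the other under-arc `x`. -/
def IsSubquandle {r : ℕ} (P : Set (ZMod r)) : Prop :=
  ∀ x ∈ P, ∀ y ∈ P, 2 * y - x ∈ P

/-- Two sets of colors generate the same subquandle. -/
def SameSpan {r : ℕ} (C C' : Set (ZMod r)) : Prop :=
  ∀ P, IsSubquandle P → (C ⊆ P ↔ C' ⊆ P)

section Rules

variable {r : ℕ}

/-- The leftmost vertical strand of a slice can be split off. -/
theorem sliceRule_succ (p : Piece) (j : ℕ) (u v : List (ZMod r)) :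
    SliceRule r ⟨p, j + 1⟩ u v ↔
      ∃ x u' v', u = x :: u' ∧ v = x :: v' ∧ SliceRule r ⟨p, j⟩ u' v' := by
  constructor
  · rintro ⟨a, b, t, t', ha, ht, rfl, rfl⟩
    obtain _ | ⟨x, a⟩ := a
    · simp at ha
    · exact ⟨x, a ++ t ++ b, a ++ t' ++ b, by simp, by simp, a, b, t, t', by simpa using ha, ht,
        rfl, rfl⟩
  · rintro ⟨x, u', v', rfl, rfl, a, b, t, t', ha, ht, rfl, rfl⟩
    exact ⟨x :: a, b, t, t', by simpa using ha, ht, by simp, by simp⟩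

theorem sliceRule_cap (u v : List (ZMod r)) :
    SliceRule r ⟨.cap, 0⟩ u v ↔ ∃ x, v = x :: x :: u := by
  constructor
  · rintro ⟨a, b, t, t', ha, ⟨x⟩, rfl, rfl⟩
    obtain rfl := List.length_eq_zero_iff.1 ha
    exact ⟨x, by simp⟩
  · rintro ⟨x, rfl⟩
    exact ⟨[], u, _, _, rfl, .cap x, rfl, rfl⟩

theorem sliceRule_cup (u v : List (ZMod r)) :
    SliceRule r ⟨.cup, 0⟩ u v ↔ ∃ x, u = x :: x :: v := by
  constructor
  · rintro ⟨a, b, t, t', ha, ht, rfl, rfl⟩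
    obtain rfl := List.length_eq_zero_iff.1 ha
    cases ht with
    | cup x => exact ⟨x, by simp⟩
  · rintro ⟨x, rfl⟩
    exact ⟨[], v, _, _, rfl, .cup x, rfl, rfl⟩

theorem sliceRule_pos (u v : List (ZMod r)) :
    SliceRule r ⟨.pos, 0⟩ u v ↔ ∃ x y b, u = x :: y :: b ∧ v = y :: (2 * y - x) :: b := by
  constructor
  · rintro ⟨a, b, t, t', ha, ht, rfl, rfl⟩
    obtain rfl := List.length_eq_zero_iff.1 ha
    cases ht with
    | pos x x' y h =>
      obtain rfl : x' = 2 * y - x := by linear_combination h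
      exact ⟨x, y, b, by simp, by simp⟩
  · rintro ⟨x, y, b, rfl, rfl⟩
    exact ⟨[], b, _, _, rfl, .pos x (2 * y - x) y (by ring), rfl, rfl⟩

theorem sliceRule_neg (u v : List (ZMod r)) :
    SliceRule r ⟨.neg, 0⟩ u v ↔ ∃ y x b, u = y :: x :: b ∧ v = (2 * y - x) :: y :: b := by
  constructor
  · rintro ⟨a, b, t, t', ha, ht, rfl, rfl⟩
    obtain rfl := List.length_eq_zero_iff.1 ha
    cases ht with
    | neg x x' y h =>
      obtain rfl : x' = 2 * y - x := by linear_combination h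
      exact ⟨y, x, b, by simp, by simp⟩
  · rintro ⟨y, x, b, rfl, rfl⟩
    exact ⟨[], b, _, _, rfl, .neg x (2 * y - x) y (by ring), rfl, rfl⟩

theorem SliceRule.add_left {p : Piece} {j : ℕ} {u v : List (ZMod r)} (a : List (ZMod r))
    (h : SliceRule r ⟨p, j⟩ u v) : SliceRule r ⟨p, a.length + j⟩ (a ++ u) (a ++ v) := by
  obtain ⟨a', b, t, t', ha, ht, rfl, rfl⟩ := h
  exact ⟨a ++ a', b, t, t', by simpa using ha, ht, by simp, by simp⟩

theorem SliceRule.length {s : Slice} {u v : List (ZMod r)} (h : SliceRule r s u v) :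
    s.left + s.piece.ins ≤ u.length ∧
      v.length = u.length - s.piece.ins + s.piece.outs := by
  obtain ⟨a, b, t, t', ha, ht, rfl, rfl⟩ := h
  cases hp : s.piece <;> rw [hp] at ht <;> cases ht <;> simp [Piece.ins, Piece.outs, ha] <;> omega

end Rules

section Tangles

variable {r : ℕ}

theorem TangleColoring.top_subset {w : List Slice} {u v : List (ZMod r)} {C : Set (ZMod r)}
    (h : TangleColoring r w u v C) : {x | x ∈ u} ⊆ C := by
  cases w with
  | nil => rw [h.2]
  | cons s w =>
    obtain ⟨_, _, _, _, rfl⟩ := h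
    exact Set.subset_union_left

theorem TangleColoring.bottom_subset {w : List Slice} {u v : List (ZMod r)} {C : Set (ZMod r)}
    (h : TangleColoring r w u v C) : {x | x ∈ v} ⊆ C := by
  induction w generalizing u C with
  | nil => obtain ⟨rfl, rfl⟩ := h; rfl
  | cons s w ih =>
    obtain ⟨_, _, _, h, rfl⟩ := h
    exact (ih h).trans Set.subset_union_right

theorem TangleColoring.fits {w : List Slice} {u v : List (ZMod r)} {C : Set (ZMod r)}
    (h : TangleColoring r w u v C) : Fits w u.length v.length := by
  induction w generalizing u C with
  | nil => obtain ⟨rfl, rfl⟩ := h; rfl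
  | cons s w ih =>
    obtain ⟨u', _, hs, h, rfl⟩ := h
    exact ⟨hs.length.1, hs.length.2 ▸ ih h⟩

theorem tangleColoring_append {A B : List Slice} {u v : List (ZMod r)} {C : Set (ZMod r)} :
    TangleColoring r (A ++ B) u v C ↔ ∃ m C₁ C₂,
      TangleColoring r A u m C₁ ∧ TangleColoring r B m v C₂ ∧ C = C₁ ∪ C₂ := by
  induction A generalizing u C with
  | nil =>
    constructor
    · intro h
      exact ⟨u, _, C, ⟨rfl, rfl⟩, h, (Set.union_eq_self_of_subset_left h.top_subset).symm⟩
    · rintro ⟨m, _, C₂, ⟨rfl, rfl⟩, h, rfl⟩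
      rwa [Set.union_eq_self_of_subset_left h.top_subset]
  | cons s A ih =>
    constructor
    · rintro ⟨u', _, hs, h, rfl⟩
      obtain ⟨m, C₁, C₂, h₁, h₂, rfl⟩ := ih.1 h
      exact ⟨m, _, C₂, ⟨u', C₁, hs, h₁, rfl⟩, h₂, (Set.union_assoc _ _ _).symm⟩
    · rintro ⟨m, _, C₂, ⟨u', C₁, hs, h₁, rfl⟩, h₂, rfl⟩
      exact ⟨u', _, hs, ih.2 ⟨m, C₁, C₂, h₁, h₂, rfl⟩, Set.union_assoc _ _ _⟩

/-- Relabelling the colors by a map that respects all crossing relations among the colors which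
occur. -/
theorem TangleColoring.map {m : ℕ} {w : List Slice} {u v : List (ZMod r)} {C : Set (ZMod r)}
    (h : TangleColoring r w u v C) (f : ZMod r → ZMod m) (S : Set (ZMod r)) (hCS : C ⊆ S)
    (hf : ∀ x ∈ S, ∀ x' ∈ S, ∀ y ∈ S, x + x' - 2 * y = 0 → f x + f x' - 2 * f y = 0) :
    TangleColoring m w (u.map f) (v.map f) (f '' C) := by
  induction w generalizing u C with
  | nil =>
    obtain ⟨rfl, rfl⟩ := h
    exact ⟨rfl, by ext; simp⟩
  | cons s w ih =>
    obtain ⟨u', C', hs, h, rfl⟩ := h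
    have hu : {x | x ∈ u} ⊆ S := Set.subset_union_left.trans hCS
    have hC' : C' ⊆ S := Set.subset_union_right.trans hCS
    have hu' : {x | x ∈ u'} ⊆ S := h.top_subset.trans hC'
    refine ⟨u'.map f, f '' C', ?_, ih h hC', by rw [Set.image_union]; congr 1; ext; simp⟩
    obtain ⟨a, b, t, t', ha, ht, rfl, rfl⟩ := hs
    refine ⟨a.map f, b.map f, t.map f, t'.map f, by simpa using ha, ?_, by simp, by simp⟩
    cases hp : s.piece <;> rw [hp] at ht <;> cases ht
    · exact .cap _
    · exact .cup _
    · rename_i x x' y hxy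
      exact .pos _ _ _ (hf x (hu (by simp)) x' (hu' (by simp)) y (hu (by simp)) hxy)
    · rename_i x x' y hxy
      exact .neg _ _ _ (hf x (hu (by simp)) x' (hu' (by simp)) y (hu (by simp)) hxy)

/-- The levels of a tangle coloring, as in `Coloring`. -/
theorem TangleColoring.exists_level {w : List Slice} {u v : List (ZMod r)} {C : Set (ZMod r)}
    (h : TangleColoring r w u v C) : ∃ level : ℕ → List (ZMod r), level 0 = u ∧
      (∀ (j : ℕ) (hj : j < w.length), SliceRule r w[j] (level j) (level (j + 1))) ∧
      (∀ j : ℕ, w.length ≤ j → level j = v) ∧ {x | ∃ j, x ∈ level j} = C := by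
  induction w generalizing u C with
  | nil =>
    obtain ⟨rfl, rfl⟩ := h
    exact ⟨fun _ => u, rfl, by simp, by simp, by simp⟩
  | cons s w ih =>
    obtain ⟨u', C', hs, h, rfl⟩ := h
    obtain ⟨l, h0, h1, h2, rfl⟩ := ih h
    refine ⟨fun j => Nat.casesOn j u l, rfl, ?_, ?_, ?_⟩
    · rintro (_ | j) hj
      · simpa [h0] using hs
      · simpa using h1 j (by simpa using hj)
    · rintro (_ | j) hj
      · simp at hj
      · exact h2 j (by simpa using hj)
    · ext x
      constructor
      · rintro ⟨_ | j, hj⟩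
        · exact Or.inl hj
        · exact Or.inr ⟨j, hj⟩
      · rintro (hx | ⟨j, hj⟩)
        · exact ⟨0, hx⟩
        · exact ⟨j + 1, hj⟩

theorem tangleColoring_of_level {w : List Slice} {v : List (ZMod r)} (level : ℕ → List (ZMod r))
    (h1 : ∀ (j : ℕ) (hj : j < w.length), SliceRule r w[j] (level j) (level (j + 1)))
    (h2 : ∀ j : ℕ, w.length ≤ j → level j = v) :
    TangleColoring r w (level 0) v {x | ∃ j, x ∈ level j} := by
  induction w generalizing level with
  | nil =>
    have h (j : ℕ) : level j = v := h2 j (by simp)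
    exact ⟨h 0, by simp [h]⟩
  | cons s w ih =>
    refine ⟨level 1, {x | ∃ j, x ∈ level (j + 1)}, h1 0 (by simp),
      ih (fun j => level (j + 1)) (fun j hj => h1 (j + 1) (by simpa using hj))
        (fun j hj => h2 (j + 1) (by simpa using hj)), ?_⟩
    ext x
    constructor
    · rintro ⟨_ | j, hj⟩
      · exact Or.inl hj
      · exact Or.inr ⟨j, hj⟩
    · rintro (hx | ⟨j, hj⟩)
      · exact ⟨0, hx⟩
      · exact ⟨j + 1, hj⟩

/-- The two notions of a coloring of a link diagram agree. -/
theorem exists_coloring_iff {D : Diagram} {C : Set (ZMod r)} :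
    (∃ c : Coloring r D, c.colors = C) ↔ TangleColoring r D.word [] [] C := by
  constructor
  · rintro ⟨c, rfl⟩
    have h := tangleColoring_of_level c.level c.rule c.bottom
    rwa [c.top] at h
  · intro h
    obtain ⟨l, h0, h1, h2, h3⟩ := h.exists_level
    exact ⟨⟨l, h0, h1, h2⟩, h3⟩

end Tangles

/-! ### Invariance under isotopies and Reidemeister moves -/

theorem SameSpan.refl {r : ℕ} (C : Set (ZMod r)) : SameSpan C C := fun _ _ => Iff.rfl

theorem SameSpan.symm {r : ℕ} {C C' : Set (ZMod r)} (h : SameSpan C C') : SameSpan C' C :=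
  fun P hP => (h P hP).symm

theorem SameSpan.trans {r : ℕ} {C C' C'' : Set (ZMod r)} (h : SameSpan C C')
    (h' : SameSpan C' C'') : SameSpan C C'' := fun P hP => (h P hP).trans (h' P hP)

theorem SameSpan.union {r : ℕ} {C C' E E' : Set (ZMod r)} (h : SameSpan C C')
    (h' : SameSpan E E') : SameSpan (C ∪ E) (C' ∪ E') := fun P hP => by
  rw [Set.union_subset_iff, Set.union_subset_iff, h P hP, h' P hP]

/-- Every coloring of `w` can be replaced by a coloring of `w'` which has the same colors at its
ends and spans the same subquandle, provided that `w'` fits below the strands at the top: an empty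
word `w` may have fewer strands than `w'` needs. -/
def ColorsTo (r : ℕ) (w w' : List Slice) : Prop :=
  ∀ u v C, (∃ k, Fits w' u.length k) → TangleColoring r w u v C →
    ∃ C', TangleColoring r w' u v C' ∧ SameSpan C C'

/-- The two words have the same colorings, up to the colors in the interior, and these span the
same subquandle. -/
def ColorEquiv (r : ℕ) (w w' : List Slice) : Prop := ColorsTo r w w' ∧ ColorsTo r w' w

/-- Adds a strand on the left of a slice. -/
def Slice.shift (s : Slice) : Slice := ⟨s.piece, s.left + 1⟩

theorem exists_fits_of_map_shift {w : List Slice} {m k : ℕ}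
    (h : Fits (w.map Slice.shift) (m + 1) k) : ∃ k', Fits w m k' := by
  induction w generalizing m with
  | nil => exact ⟨m, rfl⟩
  | cons s w ih =>
    have h₁ : s.left + 1 + s.piece.ins ≤ m + 1 := h.1
    have h₂ : Fits (w.map Slice.shift) (m + 1 - s.piece.ins + s.piece.outs) k := h.2
    rw [show m + 1 - s.piece.ins + s.piece.outs = m - s.piece.ins + s.piece.outs + 1 by omega] at h₂
    obtain ⟨k', hk'⟩ := ih h₂
    exact ⟨k', by omega, hk'⟩

theorem TangleColoring.map_shift {r : ℕ} {w : List Slice} {u v : List (ZMod r)} {C : Set (ZMod r)}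
    (x : ZMod r) (h : TangleColoring r w u v C) :
    TangleColoring r (w.map Slice.shift) (x :: u) (x :: v) ({x} ∪ C) := by
  induction w generalizing u C with
  | nil =>
    obtain ⟨rfl, rfl⟩ := h
    exact ⟨rfl, by ext; simp⟩
  | cons s w ih =>
    obtain ⟨u', C', hs, h, rfl⟩ := h
    exact ⟨x :: u', _, (sliceRule_succ _ _ _ _).2 ⟨x, u, u', rfl, rfl, hs⟩, ih h,
      by ext; simp; tauto⟩

theorem TangleColoring.of_map_shift {r : ℕ} {w : List Slice} {x : ZMod r} {u v : List (ZMod r)}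
    {C : Set (ZMod r)} (h : TangleColoring r (w.map Slice.shift) (x :: u) v C) :
    ∃ v' C', v = x :: v' ∧ TangleColoring r w u v' C' ∧ C = {x} ∪ C' := by
  induction w generalizing u C with
  | nil =>
    obtain ⟨rfl, rfl⟩ := h
    exact ⟨u, _, rfl, ⟨rfl, rfl⟩, by ext; simp⟩
  | cons s w ih =>
    obtain ⟨u', C', hs, h, rfl⟩ := h
    obtain ⟨y, u₁, u₂, hu, rfl, hs⟩ := (sliceRule_succ _ _ _ _).1 hs
    obtain ⟨rfl, rfl⟩ := List.cons.inj hu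
    obtain ⟨v', C', rfl, h', rfl⟩ := ih h
    exact ⟨v', _, rfl, ⟨u₂, C', hs, h', rfl⟩, by ext; simp; tauto⟩

theorem ColorsTo.shift {r : ℕ} {w w' : List Slice} (h : ColorsTo r w w') :
    ColorsTo r (w.map Slice.shift) (w'.map Slice.shift) := by
  intro u v C hf hC
  cases u with
  | nil =>
    -- Without strands at the top, no shifted slice fits.
    have hw : w = [] := by
      cases w with
      | nil => rfl
      | cons s w => exact absurd hC.fits.1 (by simp [Slice.shift])
    have hw' : w' = [] := by
      cases w' with
      | nil => rfl
      | cons s w => exact absurd hf.choose_spec.1 (by simp [Slice.shift])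
    subst hw hw'
    exact ⟨C, hC, .refl C⟩
  | cons x u =>
    obtain ⟨v, C, rfl, hC', rfl⟩ := hC.of_map_shift
    obtain ⟨C', h', hs⟩ := h u v C (exists_fits_of_map_shift hf.choose_spec) hC'
    exact ⟨_, h'.map_shift x, (SameSpan.refl _).union hs⟩

theorem tangleColoring_pair {r : ℕ} {s t : Slice} {u v : List (ZMod r)} {C : Set (ZMod r)} :
    TangleColoring r [s, t] u v C ↔ ∃ m, SliceRule r s u m ∧ SliceRule r t m v ∧
      C = {x | x ∈ u} ∪ ({x | x ∈ m} ∪ {x | x ∈ v}) := by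
  constructor
  · rintro ⟨m, _, h₁, ⟨_, _, h₂, ⟨rfl, rfl⟩, rfl⟩, rfl⟩
    exact ⟨m, h₁, h₂, rfl⟩
  · rintro ⟨m, h₁, h₂, rfl⟩
    exact ⟨m, _, h₁, ⟨_, _, h₂, ⟨rfl, rfl⟩, rfl⟩, rfl⟩

/-- The colors at the ends of `w` span all colors. -/
def SpannedByEnds (r : ℕ) (w : List Slice) : Prop :=
  ∀ u v C, TangleColoring r w u v C → ∀ P, IsSubquandle P →
    (∀ x ∈ u, x ∈ P) → (∀ x ∈ v, x ∈ P) → C ⊆ P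

/-- If the colors at the ends span all colors, then the spans of two colorings with the same ends
agree, and it suffices to match the colors at the ends. -/
theorem ColorEquiv.of_spannedByEnds {r : ℕ} {w w' : List Slice} (hw : SpannedByEnds r w)
    (hw' : SpannedByEnds r w')
    (h : ∀ u v, (∃ k, Fits w u.length k) → (∃ k, Fits w' u.length k) →
      ((∃ C, TangleColoring r w u v C) ↔ ∃ C, TangleColoring r w' u v C)) :
    ColorEquiv r w w' := by
  have key (u v C C') (hC : TangleColoring r w u v C) (hC' : TangleColoring r w' u v C') :
      SameSpan C C' := fun P hP =>
    ⟨fun hs => hw' u v C' hC' P hP (fun x hx => hs (hC.top_subset hx))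
      (fun x hx => hs (hC.bottom_subset hx)),
    fun hs => hw u v C hC P hP (fun x hx => hs (hC'.top_subset hx))
      (fun x hx => hs (hC'.bottom_subset hx))⟩
  constructor
  · intro u v C hf hC
    obtain ⟨C', hC'⟩ := (h u v ⟨_, hC.fits⟩ hf).1 ⟨C, hC⟩
    exact ⟨C', hC', key u v C C' hC hC'⟩
  · intro u v C hf hC
    obtain ⟨C', hC'⟩ := (h u v hf ⟨_, hC.fits⟩).2 ⟨C, hC⟩
    exact ⟨C', hC', (key u v C' C hC' hC).symm⟩

theorem spannedByEnds_nil {r : ℕ} : SpannedByEnds r [] := by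
  rintro u v C ⟨rfl, rfl⟩ P - hu -
  exact hu

theorem spannedByEnds_single {r : ℕ} {s : Slice} : SpannedByEnds r [s] := by
  rintro u v C ⟨_, _, -, ⟨rfl, rfl⟩, rfl⟩ P - hu hv
  exact Set.union_subset hu hv

theorem spannedByEnds_pair {r : ℕ} {s t : Slice}
    (h : ∀ u m v, SliceRule r s u m → SliceRule r t m v → ∀ P, IsSubquandle P →
      (∀ x ∈ u, x ∈ P) → (∀ x ∈ v, x ∈ P) → ∀ x ∈ m, x ∈ P) : SpannedByEnds r [s, t] := by
  rintro u v C hC P hP hu hv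
  obtain ⟨m, h₁, h₂, rfl⟩ := tangleColoring_pair.1 hC
  exact Set.union_subset hu (Set.union_subset (h u m v h₁ h₂ P hP hu hv) hv)

theorem exists_tangleColoring_nil {r : ℕ} {u v : List (ZMod r)} :
    (∃ C, TangleColoring r [] u v C) ↔ u = v :=
  ⟨fun ⟨_, h⟩ => h.1, fun h => ⟨_, h, rfl⟩⟩

theorem exists_tangleColoring_cons {r : ℕ} {s : Slice} {w : List Slice} {u v : List (ZMod r)} :
    (∃ C, TangleColoring r (s :: w) u v C) ↔
      ∃ m, SliceRule r s u m ∧ ∃ C, TangleColoring r w m v C :=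
  ⟨fun ⟨_, m, C, hs, h, _⟩ => ⟨m, hs, C, h⟩, fun ⟨m, hs, C, h⟩ => ⟨_, m, C, hs, h, rfl⟩⟩

theorem colorEquiv_zigzag_right {r : ℕ} :
    ColorEquiv r [⟨.cap, 1⟩, ⟨.cup, 0⟩] [] := by
  refine .of_spannedByEnds (spannedByEnds_pair fun u m v h₁ h₂ P hP hu hv => by
      simp only [sliceRule_succ, sliceRule_cap, sliceRule_cup] at h₁ h₂
      grind) spannedByEnds_nil fun u v hf hf' => ?_
  simp only [exists_tangleColoring_nil, exists_tangleColoring_cons, sliceRule_succ,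
    sliceRule_cap, sliceRule_cup]
  constructor
  · grind
  · have hk : 1 ≤ u.length := hf.choose_spec.1
    obtain _ | ⟨x, u⟩ := u
    · simp at hk
    · rintro rfl
      exact ⟨_, ⟨x, u, _, rfl, rfl, x, rfl⟩, _, ⟨x, rfl⟩, rfl⟩

theorem colorEquiv_zigzag_left {r : ℕ} :
    ColorEquiv r [⟨.cap, 0⟩, ⟨.cup, 1⟩] [] := by
  refine .of_spannedByEnds (spannedByEnds_pair fun u m v h₁ h₂ P hP hu hv => by
      simp only [sliceRule_succ, sliceRule_cap, sliceRule_cup] at h₁ h₂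
      grind) spannedByEnds_nil fun u v hf hf' => ?_
  simp only [exists_tangleColoring_nil, exists_tangleColoring_cons, sliceRule_succ,
    sliceRule_cap, sliceRule_cup]
  constructor
  · grind
  · have hk : 3 ≤ u.length + 2 := hf.choose_spec.2.1
    obtain _ | ⟨x, u⟩ := u
    · simp at hk
    · rintro rfl
      exact ⟨_, ⟨x, rfl⟩, _, ⟨x, _, u, rfl, rfl, x, rfl⟩, rfl⟩

theorem colorEquiv_slide_cap_pos {r : ℕ} :
    ColorEquiv r [⟨.cap, 0⟩, ⟨.pos, 1⟩] [⟨.cap, 1⟩, ⟨.neg, 0⟩] := by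
  refine .of_spannedByEnds (spannedByEnds_pair fun u m v h₁ h₂ P hP hu hv => by
      simp only [sliceRule_succ, sliceRule_cap, sliceRule_pos] at h₁ h₂
      grind) (spannedByEnds_pair fun u m v h₁ h₂ P hP hu hv => by
      simp only [sliceRule_succ, sliceRule_cap, sliceRule_neg] at h₁ h₂
      grind) fun u v hf hf' => ?_
  simp only [exists_tangleColoring_nil, exists_tangleColoring_cons, sliceRule_succ,
    sliceRule_cap, sliceRule_pos, sliceRule_neg]
  constructor
  · grind
  · rintro ⟨_, ⟨x, u, _, rfl, rfl, t, rfl⟩, _, ⟨y, z, b, h, rfl⟩, rfl⟩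
    simp only [List.cons.injEq] at h
    obtain ⟨rfl, rfl, rfl⟩ := h
    -- The new maximum gets the color of the other end of the under-arc.
    exact ⟨_, ⟨2 * x - t, rfl⟩, _, ⟨_, _, _, rfl, rfl, _, _, _, rfl, rfl⟩, by simp⟩

theorem colorEquiv_slide_cap_neg {r : ℕ} :
    ColorEquiv r [⟨.cap, 0⟩, ⟨.neg, 1⟩] [⟨.cap, 1⟩, ⟨.pos, 0⟩] := by
  refine .of_spannedByEnds (spannedByEnds_pair fun u m v h₁ h₂ P hP hu hv => by
      simp only [sliceRule_succ, sliceRule_cap, sliceRule_neg] at h₁ h₂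
      grind) (spannedByEnds_pair fun u m v h₁ h₂ P hP hu hv => by
      simp only [sliceRule_succ, sliceRule_cap, sliceRule_pos] at h₁ h₂
      grind) fun u v hf hf' => ?_
  simp only [exists_tangleColoring_nil, exists_tangleColoring_cons, sliceRule_succ,
    sliceRule_cap, sliceRule_pos, sliceRule_neg]
  constructor
  · grind
  · grind

theorem colorEquiv_slide_cup_pos {r : ℕ} :
    ColorEquiv r [⟨.pos, 1⟩, ⟨.cup, 0⟩] [⟨.neg, 0⟩, ⟨.cup, 1⟩] := by
  refine .of_spannedByEnds (spannedByEnds_pair fun u m v h₁ h₂ P hP hu hv => by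
      simp only [sliceRule_succ, sliceRule_cup, sliceRule_pos] at h₁ h₂
      grind) (spannedByEnds_pair fun u m v h₁ h₂ P hP hu hv => by
      simp only [sliceRule_succ, sliceRule_cup, sliceRule_neg] at h₁ h₂
      grind) fun u v hf hf' => ?_
  simp only [exists_tangleColoring_nil, exists_tangleColoring_cons, sliceRule_succ,
    sliceRule_cup, sliceRule_pos, sliceRule_neg]
  constructor
  · grind
  · grind

theorem colorEquiv_slide_cup_neg {r : ℕ} :
    ColorEquiv r [⟨.neg, 1⟩, ⟨.cup, 0⟩] [⟨.pos, 0⟩, ⟨.cup, 1⟩] := by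
  refine .of_spannedByEnds (spannedByEnds_pair fun u m v h₁ h₂ P hP hu hv => by
      simp only [sliceRule_succ, sliceRule_cup, sliceRule_neg] at h₁ h₂
      grind) (spannedByEnds_pair fun u m v h₁ h₂ P hP hu hv => by
      simp only [sliceRule_succ, sliceRule_cup, sliceRule_pos] at h₁ h₂
      grind) fun u v hf hf' => ?_
  simp only [exists_tangleColoring_nil, exists_tangleColoring_cons, sliceRule_succ,
    sliceRule_cup, sliceRule_pos, sliceRule_neg]
  constructor
  · rintro ⟨_, ⟨x, _, _, rfl, rfl, y, z, b, rfl, rfl⟩, _, ⟨t, h⟩, rfl⟩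
    simp only [List.cons.injEq] at h
    obtain ⟨rfl, rfl, rfl⟩ := h
    exact ⟨_, ⟨_, _, _, rfl, rfl⟩, _, ⟨y, _, _, rfl, rfl, z, by simp⟩, rfl⟩
  · grind

theorem colorEquiv_reidemeister1_cap_pos {r : ℕ} :
    ColorEquiv r [⟨.cap, 0⟩, ⟨.pos, 0⟩] [⟨.cap, 0⟩] := by
  refine .of_spannedByEnds (spannedByEnds_pair fun u m v h₁ h₂ P hP hu hv => by
      simp only [sliceRule_cap, sliceRule_pos] at h₁ h₂
      grind) spannedByEnds_single fun u v hf hf' => ?_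
  simp only [exists_tangleColoring_nil, exists_tangleColoring_cons, sliceRule_cap, sliceRule_pos]
  have e (a : ZMod r) : 2 * a - a = a := by ring
  constructor
  · grind
  · rintro ⟨_, ⟨x, rfl⟩, rfl⟩
    exact ⟨_, ⟨x, rfl⟩, _, ⟨x, x, u, rfl, rfl⟩, by simp [e]⟩

theorem colorEquiv_reidemeister1_cap_neg {r : ℕ} :
    ColorEquiv r [⟨.cap, 0⟩, ⟨.neg, 0⟩] [⟨.cap, 0⟩] := by
  refine .of_spannedByEnds (spannedByEnds_pair fun u m v h₁ h₂ P hP hu hv => by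
      simp only [sliceRule_cap, sliceRule_neg] at h₁ h₂
      grind) spannedByEnds_single fun u v hf hf' => ?_
  simp only [exists_tangleColoring_nil, exists_tangleColoring_cons, sliceRule_cap, sliceRule_neg]
  have e (a : ZMod r) : 2 * a - a = a := by ring
  constructor
  · grind
  · rintro ⟨_, ⟨x, rfl⟩, rfl⟩
    exact ⟨_, ⟨x, rfl⟩, _, ⟨x, x, u, rfl, rfl⟩, by simp [e]⟩

theorem colorEquiv_reidemeister1_cup_pos {r : ℕ} :
    ColorEquiv r [⟨.pos, 0⟩, ⟨.cup, 0⟩] [⟨.cup, 0⟩] := by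
  refine .of_spannedByEnds (spannedByEnds_pair fun u m v h₁ h₂ P hP hu hv => by
      simp only [sliceRule_cup, sliceRule_pos] at h₁ h₂
      grind) spannedByEnds_single fun u v hf hf' => ?_
  simp only [exists_tangleColoring_nil, exists_tangleColoring_cons, sliceRule_cup, sliceRule_pos]
  have e (a : ZMod r) : 2 * a - a = a := by ring
  constructor
  · grind
  · rintro ⟨_, ⟨x, rfl⟩, rfl⟩
    exact ⟨_, ⟨x, x, _, rfl, rfl⟩, _, ⟨x, by simp [e]⟩, rfl⟩

theorem colorEquiv_reidemeister1_cup_neg {r : ℕ} :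
    ColorEquiv r [⟨.neg, 0⟩, ⟨.cup, 0⟩] [⟨.cup, 0⟩] := by
  refine .of_spannedByEnds (spannedByEnds_pair fun u m v h₁ h₂ P hP hu hv => by
      simp only [sliceRule_cup, sliceRule_neg] at h₁ h₂
      grind) spannedByEnds_single fun u v hf hf' => ?_
  simp only [exists_tangleColoring_nil, exists_tangleColoring_cons, sliceRule_cup, sliceRule_neg]
  have e (a : ZMod r) : 2 * a - a = a := by ring
  constructor
  · grind
  · rintro ⟨_, ⟨x, rfl⟩, rfl⟩
    exact ⟨_, ⟨x, x, _, rfl, rfl⟩, _, ⟨x, by simp [e]⟩, rfl⟩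

theorem colorEquiv_reidemeister2_pos {r : ℕ} :
    ColorEquiv r [⟨.pos, 0⟩, ⟨.neg, 0⟩] [] := by
  refine .of_spannedByEnds ?_ spannedByEnds_nil fun u v hf hf' => ?_
  · refine spannedByEnds_pair fun u m v h₁ h₂ P hP hu hv => ?_
    simp only [sliceRule_pos, sliceRule_neg] at h₁ h₂
    obtain ⟨x, y, b, rfl, rfl⟩ := h₁
    have := hP x (hu _ (by simp)) y (hu _ (by simp))
    grind
  simp only [exists_tangleColoring_nil, exists_tangleColoring_cons, sliceRule_pos, sliceRule_neg]
  constructor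
  · grind
  · have hk : 2 ≤ u.length := hf.choose_spec.1.trans' (by simp [Piece.ins])
    obtain _ | ⟨x, _ | ⟨y, u⟩⟩ := u
    · simp at hk
    · simp at hk
    · rintro rfl
      exact ⟨_, ⟨x, y, u, rfl, rfl⟩, _, ⟨_, _, _, rfl, rfl⟩, by simp⟩

theorem colorEquiv_reidemeister2_neg {r : ℕ} :
    ColorEquiv r [⟨.neg, 0⟩, ⟨.pos, 0⟩] [] := by
  refine .of_spannedByEnds ?_ spannedByEnds_nil fun u v hf hf' => ?_
  · refine spannedByEnds_pair fun u m v h₁ h₂ P hP hu hv => ?_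
    simp only [sliceRule_pos, sliceRule_neg] at h₁ h₂
    obtain ⟨x, y, b, rfl, rfl⟩ := h₁
    have := hP y (hu _ (by simp)) x (hu _ (by simp))
    grind
  simp only [exists_tangleColoring_nil, exists_tangleColoring_cons, sliceRule_pos, sliceRule_neg]
  constructor
  · grind
  · have hk : 2 ≤ u.length := hf.choose_spec.1.trans' (by simp [Piece.ins])
    obtain _ | ⟨x, _ | ⟨y, u⟩⟩ := u
    · simp at hk
    · simp at hk
    · rintro rfl
      exact ⟨_, ⟨x, y, u, rfl, rfl⟩, _, ⟨_, _, _, rfl, rfl⟩, by simp⟩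

theorem colorEquiv_reidemeister3 {r : ℕ} :
    ColorEquiv r [⟨.pos, 0⟩, ⟨.pos, 1⟩, ⟨.pos, 0⟩] [⟨.pos, 1⟩, ⟨.pos, 0⟩, ⟨.pos, 1⟩] := by
  refine .of_spannedByEnds ?_ ?_ fun u v hf hf' => ?_
  · rintro u v C ⟨u₁, _, h₁, ⟨u₂, _, h₂, ⟨u₃, _, h₃, ⟨rfl, rfl⟩, rfl⟩, rfl⟩, rfl⟩ P hP hu hv
    simp only [sliceRule_succ, sliceRule_pos] at h₁ h₂ h₃
    obtain ⟨x, y, b, rfl, rfl⟩ := h₁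
    have := hP x (hu _ (by simp)) y (hu _ (by simp))
    grind
  · rintro u v C ⟨u₁, _, h₁, ⟨u₂, _, h₂, ⟨u₃, _, h₃, ⟨rfl, rfl⟩, rfl⟩, rfl⟩, rfl⟩ P hP hu hv
    simp only [sliceRule_succ, sliceRule_pos] at h₁ h₂ h₃
    obtain ⟨x, _, _, rfl, rfl, y, z, b, rfl, rfl⟩ := h₁
    have := hP x (hu _ (by simp)) z (hu _ (by simp))
    grind
  · simp only [exists_tangleColoring_nil, exists_tangleColoring_cons, sliceRule_succ,
      sliceRule_pos]
    constructor
    · grind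
    · grind

theorem sliceRule_add {r : ℕ} {p : Piece} {i j : ℕ} {u v : List (ZMod r)} :
    SliceRule r ⟨p, i + j⟩ u v ↔ ∃ a u' v', a.length = i ∧ u = a ++ u' ∧ v = a ++ v' ∧
      SliceRule r ⟨p, j⟩ u' v' := by
  constructor
  · rintro ⟨a, b, t, t', ha, ht, rfl, rfl⟩
    have ha : a.length = i + j := ha
    exact ⟨a.take i, a.drop i ++ t ++ b, a.drop i ++ t' ++ b, by simp [ha],
      by simp [← List.append_assoc], by simp [← List.append_assoc],
      a.drop i, b, t, t', by simp [ha], ht, rfl, rfl⟩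
  · rintro ⟨a, u, v, rfl, rfl, rfl, h⟩
    exact h.add_left a

theorem sliceRule_zero {r : ℕ} {p : Piece} {u v : List (ZMod r)} :
    SliceRule r ⟨p, 0⟩ u v ↔ ∃ t t' b, PieceRule r p t t' ∧ u = t ++ b ∧ v = t' ++ b := by
  constructor
  · rintro ⟨a, b, t, t', ha, ht, rfl, rfl⟩
    obtain rfl := List.length_eq_zero_iff.1 ha
    exact ⟨t, t', b, ht, rfl, rfl⟩
  · rintro ⟨t, t', b, ht, rfl, rfl⟩
    exact ⟨[], b, t, t', rfl, ht, rfl, rfl⟩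

theorem PieceRule.length_ins {r : ℕ} {p : Piece} {t t' : List (ZMod r)} (h : PieceRule r p t t') :
    t.length = p.ins := by cases h <;> rfl

theorem PieceRule.length_outs {r : ℕ} {p : Piece} {t t' : List (ZMod r)}
    (h : PieceRule r p t t') : t'.length = p.outs := by cases h <;> rfl

/-- Two colored pieces that act on disjoint groups of strands: normal form of the coloring in which
the right piece is the upper one. -/
theorem sliceRule_right_left {r : ℕ} {p q : Piece} {j : ℕ} {u m v : List (ZMod r)} :
    SliceRule r ⟨q, p.ins + j⟩ u m ∧ SliceRule r ⟨p, 0⟩ m v ↔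
      ∃ t t' b b', PieceRule r p t t' ∧ SliceRule r ⟨q, j⟩ b b' ∧
        u = t ++ b ∧ m = t ++ b' ∧ v = t' ++ b' := by
  constructor
  · rintro ⟨h₁, h₂⟩
    obtain ⟨a, b, b', ha, rfl, rfl, h⟩ := sliceRule_add.1 h₁
    obtain ⟨t, t', b'', ht, hm, rfl⟩ := sliceRule_zero.1 h₂
    obtain ⟨rfl, rfl⟩ := List.append_inj hm (ha.trans ht.length_ins.symm)
    exact ⟨a, t', b, b', ht, h, rfl, rfl, rfl⟩
  · rintro ⟨t, t', b, b', ht, h, rfl, rfl, rfl⟩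
    exact ⟨sliceRule_add.2 ⟨t, b, b', ht.length_ins, rfl, rfl, h⟩,
      sliceRule_zero.2 ⟨t, t', b', ht, rfl, rfl⟩⟩

/-- Two colored pieces that act on disjoint groups of strands: normal form of the coloring in which
the left piece is the upper one. -/
theorem sliceRule_left_right {r : ℕ} {p q : Piece} {j : ℕ} {u m v : List (ZMod r)} :
    SliceRule r ⟨p, 0⟩ u m ∧ SliceRule r ⟨q, p.outs + j⟩ m v ↔
      ∃ t t' b b', PieceRule r p t t' ∧ SliceRule r ⟨q, j⟩ b b' ∧
        u = t ++ b ∧ m = t' ++ b ∧ v = t' ++ b' := by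
  constructor
  · rintro ⟨h₁, h₂⟩
    obtain ⟨a, b, b', ha, rfl, rfl, h⟩ := sliceRule_add.1 h₂
    obtain ⟨t, t', b'', ht, rfl, hm⟩ := sliceRule_zero.1 h₁
    obtain ⟨rfl, rfl⟩ := List.append_inj hm (ha.trans ht.length_outs.symm)
    exact ⟨t, a, b, b', ht, h, rfl, rfl, rfl⟩
  · rintro ⟨t, t', b, b', ht, h, rfl, rfl, rfl⟩
    exact ⟨sliceRule_zero.2 ⟨t, t', b, ht, rfl, rfl⟩,
      sliceRule_add.2 ⟨t', b, b', ht.length_outs, rfl, rfl, h⟩⟩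

theorem colorEquiv_exchange {r : ℕ} (p q : Piece) (j : ℕ) :
    ColorEquiv r [⟨q, p.ins + j⟩, ⟨p, 0⟩] [⟨p, 0⟩, ⟨q, p.outs + j⟩] := by
  refine .of_spannedByEnds (spannedByEnds_pair fun u m v h₁ h₂ P hP hu hv => ?_)
    (spannedByEnds_pair fun u m v h₁ h₂ P hP hu hv => ?_) fun u v hf hf' => ?_
  · obtain ⟨t, t', b, b', -, -, rfl, rfl, rfl⟩ := sliceRule_right_left.1 ⟨h₁, h₂⟩
    grind
  · obtain ⟨t, t', b, b', -, -, rfl, rfl, rfl⟩ := sliceRule_left_right.1 ⟨h₁, h₂⟩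
    grind
  · simp only [exists_tangleColoring_nil, exists_tangleColoring_cons]
    constructor
    · rintro ⟨m, h₁, _, h₂, rfl⟩
      obtain ⟨t, t', b, b', ht, hs, rfl, rfl, rfl⟩ := sliceRule_right_left.1 ⟨h₁, h₂⟩
      obtain ⟨h₁, h₂⟩ := sliceRule_left_right.2 ⟨t, t', b, b', ht, hs, rfl, rfl, rfl⟩
      exact ⟨_, h₁, _, h₂, rfl⟩
    · rintro ⟨m, h₁, _, h₂, rfl⟩
      obtain ⟨t, t', b, b', ht, hs, rfl, rfl, rfl⟩ := sliceRule_left_right.1 ⟨h₁, h₂⟩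
      obtain ⟨h₁, h₂⟩ := sliceRule_right_left.2 ⟨t, t', b, b', ht, hs, rfl, rfl, rfl⟩
      exact ⟨_, h₁, _, h₂, rfl⟩

theorem ColorEquiv.map_shift_iterate {r : ℕ} {w w' : List Slice} (h : ColorEquiv r w w') (i : ℕ) :
    ColorEquiv r (w.map Slice.shift^[i]) (w'.map Slice.shift^[i]) := by
  induction i with
  | zero => simpa using h
  | succ i ih =>
    have := And.intro ih.1.shift ih.2.shift
    simpa only [ColorEquiv, List.map_map, ← Function.iterate_succ'] using this

theorem shift_iterate (s : Slice) (i : ℕ) : Slice.shift^[i] s = ⟨s.piece, i + s.left⟩ := by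
  induction i with
  | zero => simp
  | succ i ih => rw [Function.iterate_succ_apply', ih, Slice.shift, Nat.succ_add_eq_add_succ]; rfl

theorem LocalMove.colorEquiv {r : ℕ} {w w' : List Slice} (h : LocalMove w w') :
    ColorEquiv r w w' := by
  cases h with
  | zigzag_right i => simpa [shift_iterate] using
      colorEquiv_zigzag_right.map_shift_iterate (r := r) i
  | zigzag_left i => simpa [shift_iterate] using
      colorEquiv_zigzag_left.map_shift_iterate (r := r) i
  | exchange p q i j =>
    simpa [shift_iterate, add_assoc] using (colorEquiv_exchange p q j).map_shift_iterate (r := r) i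
  | slide_cap_pos i =>
    simpa [shift_iterate] using
      colorEquiv_slide_cap_pos.map_shift_iterate (r := r) i
  | slide_cap_neg i =>
    simpa [shift_iterate] using
      colorEquiv_slide_cap_neg.map_shift_iterate (r := r) i
  | slide_cup_pos i =>
    simpa [shift_iterate] using
      colorEquiv_slide_cup_pos.map_shift_iterate (r := r) i
  | slide_cup_neg i =>
    simpa [shift_iterate] using
      colorEquiv_slide_cup_neg.map_shift_iterate (r := r) i
  | reidemeister1_cap_pos i =>
    simpa [shift_iterate] using
      colorEquiv_reidemeister1_cap_pos.map_shift_iterate (r := r) i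
  | reidemeister1_cap_neg i =>
    simpa [shift_iterate] using
      colorEquiv_reidemeister1_cap_neg.map_shift_iterate (r := r) i
  | reidemeister1_cup_pos i =>
    simpa [shift_iterate] using
      colorEquiv_reidemeister1_cup_pos.map_shift_iterate (r := r) i
  | reidemeister1_cup_neg i =>
    simpa [shift_iterate] using
      colorEquiv_reidemeister1_cup_neg.map_shift_iterate (r := r) i
  | reidemeister2_pos i =>
    simpa [shift_iterate] using
      colorEquiv_reidemeister2_pos.map_shift_iterate (r := r) i
  | reidemeister2_neg i =>
    simpa [shift_iterate] using
      colorEquiv_reidemeister2_neg.map_shift_iterate (r := r) i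
  | reidemeister3 i =>
    simpa [shift_iterate] using
      colorEquiv_reidemeister3.map_shift_iterate (r := r) i

theorem fits_append {A B : List Slice} {m n : ℕ} :
    Fits (A ++ B) m n ↔ ∃ k, Fits A m k ∧ Fits B k n := by
  induction A generalizing m with
  | nil => simp [Fits]
  | cons s A ih => simp [Fits, ih, and_assoc]

theorem Fits.unique {w : List Slice} {m n n' : ℕ} (h : Fits w m n) (h' : Fits w m n') :
    n = n' := by
  induction w generalizing m with
  | nil => exact h.symm.trans h'
  | cons s w ih => exact ih h.2 h'.2

theorem ColorsTo.exists_append {r : ℕ} {A B w w' : List Slice} {C : Set (ZMod r)}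
    (h : ColorsTo r w w') (hf : Fits (A ++ w' ++ B) 0 0)
    (hC : TangleColoring r (A ++ w ++ B) [] [] C) :
    ∃ C', TangleColoring r (A ++ w' ++ B) [] [] C' ∧ SameSpan C C' := by
  obtain ⟨v, _, C₃, h₁₂, h₃, rfl⟩ := tangleColoring_append.1 hC
  obtain ⟨u, C₁, C₂, h₁, h₂, rfl⟩ := tangleColoring_append.1 h₁₂
  obtain ⟨n, hf₁₂, -⟩ := fits_append.1 hf
  obtain ⟨m, hf₁, hf₂⟩ := fits_append.1 hf₁₂
  obtain rfl := hf₁.unique h₁.fits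
  obtain ⟨C₂', h₂', hs⟩ := h u v C₂ ⟨n, hf₂⟩ h₂
  exact ⟨_, tangleColoring_append.2 ⟨v, _, C₃, tangleColoring_append.2 ⟨u, C₁, C₂', h₁, h₂', rfl⟩,
    h₃, rfl⟩, ((SameSpan.refl C₁).union hs).union (SameSpan.refl C₃)⟩

/-- Colorings carry over to any other diagram of the same link, and they span the same subquandle
there. -/
theorem exists_tangleColoring_of_mk_eq {r : ℕ} {D D' : Diagram}
    (h : Quot.mk Diagram.Move D = Quot.mk Diagram.Move D') {C : Set (ZMod r)}
    (hC : TangleColoring r D.word [] [] C) :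
    ∃ C', TangleColoring r D'.word [] [] C' ∧ SameSpan C C' := by
  let Q (D D' : Diagram) : Prop := ∀ C : Set (ZMod r), TangleColoring r D.word [] [] C →
    ∃ C', TangleColoring r D'.word [] [] C' ∧ SameSpan C C'
  suffices Q D D' ∧ Q D' D from this.1 C hC
  have h' := Quot.eqvGen_exact h
  clear h hC C
  induction h' with
  | rel D D' h =>
    obtain ⟨A, B, w, w', hw, hD, hD'⟩ := h
    constructor
    · intro C hC
      rw [hD] at hC
      rw [hD']
      exact hw.colorEquiv.1.exists_append (hD' ▸ D'.closed) hC
    · intro C hC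
      rw [hD'] at hC
      rw [hD]
      exact hw.colorEquiv.2.exists_append (hD ▸ D.closed) hC
  | refl D => exact ⟨fun C hC => ⟨C, hC, .refl C⟩, fun C hC => ⟨C, hC, .refl C⟩⟩
  | symm D D' _ ih => exact ih.symm
  | trans D D' D'' _ _ ih ih' =>
    have trans {D D' D'' : Diagram} (h : Q D D') (h' : Q D' D'') : Q D D'' := fun C hC => by
      obtain ⟨C', hC', hs⟩ := h C hC
      obtain ⟨C'', hC'', hs'⟩ := h' C' hC'
      exact ⟨C'', hC'', hs.trans hs'⟩
    exact ⟨trans ih.1 ih'.1, trans ih'.2 ih.2⟩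

/-! ### Colorings of torus links and lower bounds -/

/-- Along a twist the colors form an arithmetic progression. -/
theorem tangleColoring_replicate_pos {r n : ℕ} {x y : ZMod r} {b v : List (ZMod r)}
    {C : Set (ZMod r)} (h : TangleColoring r (List.replicate n ⟨.pos, 0⟩) (x :: y :: b) v C) :
    v = (x + n * (y - x)) :: (y + n * (y - x)) :: b ∧
      C ⊆ {z | ∃ i : ℕ, z = x + i * (y - x)} ∪ {z | z ∈ b} := by
  induction n generalizing x y C with
  | zero =>
    obtain ⟨rfl, rfl⟩ := h
    refine ⟨by simp, ?_⟩
    intro z hz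
    simp only [Set.mem_ofPred_eq, List.mem_cons] at hz
    rcases hz with rfl | rfl | hz
    · exact Or.inl ⟨0, by simp⟩
    · exact Or.inl ⟨1, by simp⟩
    · exact Or.inr hz
  | succ n ih =>
    obtain ⟨u, C, hs, h, rfl⟩ := h
    obtain ⟨x', y', b', hu, rfl⟩ := (sliceRule_pos _ _).1 hs
    simp only [List.cons.injEq] at hu
    obtain ⟨rfl, rfl, rfl⟩ := hu
    obtain ⟨rfl, hC⟩ := ih h
    refine ⟨by push_cast; congr 1; · ring
               congr 1; ring, Set.union_subset ?_ fun z hz => ?_⟩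
    · intro z hz
      simp only [Set.mem_ofPred_eq, List.mem_cons] at hz
      rcases hz with rfl | rfl | hz
      · exact Or.inl ⟨0, by simp⟩
      · exact Or.inl ⟨1, by simp⟩
      · exact Or.inr hz
    · rcases hC hz with ⟨i, rfl⟩ | hz
      · exact Or.inl ⟨i + 1, by push_cast; ring⟩
      · exact Or.inr hz

/-- With the colors `x`, `y` on top of the braid, the colors are `x + i (y - x)`, and closing up
forces `n (y - x) = 0`. -/
theorem mul_sub_eq_zero_of_torusDiagram {r n : ℕ} {C : Set (ZMod r)}
    (h : TangleColoring r (torusDiagram n).word [] [] C) :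
    ∃ x, ∀ z ∈ C, (n : ZMod r) * (z - x) = 0 := by
  obtain ⟨u₁, _, h₁, ⟨u₂, C₂, h₂, h, rfl⟩, rfl⟩ := h
  obtain ⟨u₃, C₃, C₄, h₃, h₄, rfl⟩ := tangleColoring_append.1 h
  obtain ⟨u₄, _, h₄, ⟨_, _, h₅, ⟨rfl, rfl⟩, rfl⟩, rfl⟩ := h₄
  obtain ⟨x, rfl⟩ := (sliceRule_cap _ _).1 h₁
  obtain ⟨_, _, _, h', rfl, h₂'⟩ := (sliceRule_succ _ _ _ _).1 h₂
  obtain ⟨y, rfl⟩ := (sliceRule_cap _ _).1 h₂'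
  simp only [List.cons.injEq] at h'
  obtain ⟨rfl, rfl⟩ := h'
  obtain ⟨rfl, hC⟩ := tangleColoring_replicate_pos h₃
  obtain ⟨z, _, _, h'', rfl, h₄'⟩ := (sliceRule_succ _ _ _ _).1 h₄
  obtain ⟨t, rfl⟩ := (sliceRule_cup _ _).1 h₄'
  obtain ⟨s, hs⟩ := (sliceRule_cup _ _).1 h₅
  simp only [List.cons.injEq] at h'' hs
  obtain ⟨rfl, hyt, rfl, rfl⟩ := h''
  have hn : (n : ZMod r) * (y - x) = 0 := by linear_combination hyt
  refine ⟨x, fun z hz => ?_⟩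
  have hy (i : ℕ) : (n : ZMod r) * (x + i * (y - x) - x) = 0 := by linear_combination i * hn
  have hC' : ∀ z ∈ C₃, (n : ZMod r) * (z - x) = 0 := by
    intro z hz
    rcases hC hz with ⟨i, rfl⟩ | hz
    · exact hy i
    · simp only [Set.mem_ofPred_eq, List.mem_cons, List.not_mem_nil, or_false] at hz
      rcases hz with rfl | rfl
      · exact hn
      · simp
  simp only [hn, add_zero, Set.mem_union, Set.mem_ofPred_eq, List.mem_cons, List.not_mem_nil,
    or_false, false_or] at hz
  rcases hz with hz | hz | hz | hz
  all_goals grind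

/-- The colors of any coloring of any diagram of `T(2, n)` differ by `n`-torsion: the cosets of the
`n`-torsion are subquandles, so this carries over from the standard diagram. -/
theorem mul_sub_eq_zero {r n : ℕ} {D : Diagram} (hD : D.IsDiagramOf (torusLink n))
    {C : Set (ZMod r)} (h : TangleColoring r D.word [] [] C) {z z' : ZMod r} (hz : z ∈ C)
    (hz' : z' ∈ C) : (n : ZMod r) * (z - z') = 0 := by
  obtain ⟨C', hC', hs⟩ := exists_tangleColoring_of_mk_eq hD h
  obtain ⟨x, hx⟩ := mul_sub_eq_zero_of_torusDiagram hC'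
  have hP : IsSubquandle {z : ZMod r | (n : ZMod r) * (z - x) = 0} := fun a ha b hb => by
    simp only [Set.mem_ofPred_eq] at ha hb ⊢
    linear_combination 2 * hb - ha
  have hC := (hs _ hP).2 hx
  have h₁ : (n : ZMod r) * (z - x) = 0 := hC hz
  have h₂ : (n : ZMod r) * (z' - x) = 0 := hC hz'
  linear_combination h₁ - h₂

/-- A relabelling of the colors by elements of `ℤ/(n+1)` that respects the crossing relations
collapses all colors, as `T(2, n)` has only trivial colorings modulo a number prime to `n`. -/
theorem relabel_const {r n : ℕ} {D : Diagram} (hD : D.IsDiagramOf (torusLink n))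
    {C : Set (ZMod r)} (h : TangleColoring r D.word [] [] C) (f : ZMod r → ZMod (n + 1))
    (hf : ∀ x ∈ C, ∀ x' ∈ C, ∀ y ∈ C, x + x' - 2 * y = 0 → f x + f x' - 2 * f y = 0)
    {z z' : ZMod r} (hz : z ∈ C) (hz' : z' ∈ C) : f z = f z' := by
  have key := mul_sub_eq_zero hD (h.map f C subset_rfl hf) (Set.mem_image_of_mem f hz)
    (Set.mem_image_of_mem f hz')
  have hn : (n : ZMod (n + 1)) + 1 = 0 := by exact_mod_cast ZMod.natCast_self (n + 1)
  linear_combination (f z - f z') * hn - key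

section LowerBound

variable {r n : ℕ} {D : Diagram} {C : Set (ZMod r)}

open Classical in
/-- If only one color met at each crossing, then the colors could be changed arbitrarily; in the
absence of 2-torsion, a crossing that is not of this kind has three distinct colors. -/
theorem exists_nontrivial_relation (hn : 0 < n) (hD : D.IsDiagramOf (torusLink n))
    (h : TangleColoring r D.word [] [] C) (hC : C.Nontrivial)
    (h2 : ∀ z ∈ C, ∀ z' ∈ C, 2 * (z - z') = 0 → z = z') :
    ∃ x ∈ C, ∃ x' ∈ C, ∃ y ∈ C, x + x' - 2 * y = 0 ∧ x ≠ y ∧ x' ≠ y ∧ x ≠ x' := by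
  by_contra! hcon
  have : Fact (1 < n + 1) := ⟨by omega⟩
  obtain ⟨a, ha, b, hb, hab⟩ := hC
  have key := relabel_const hD h (fun z => if z = a then 0 else 1) ?_ ha hb
  · simp [hab.symm] at key
  · intro x hx x' hx' y hy hxy
    have hxy' : x = y ∧ x' = y := by
      by_cases h₁ : x = y
      · exact ⟨h₁, by linear_combination hxy - h₁⟩
      · by_cases h₂ : x' = y
        · exact ⟨by linear_combination hxy - h₂, h₂⟩
        · have h₃ := hcon x hx x' hx' y hy hxy h₁ h₂
          exact absurd (h2 x hx y hy (by linear_combination hxy + h₃)) h₁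
    obtain ⟨rfl, rfl⟩ := hxy'
    ring

theorem three_le_encard (hn : 0 < n) (hD : D.IsDiagramOf (torusLink n))
    (h : TangleColoring r D.word [] [] C) (hC : C.Nontrivial)
    (h2 : ∀ z ∈ C, ∀ z' ∈ C, 2 * (z - z') = 0 → z = z') : 3 ≤ C.encard := by
  obtain ⟨x, hx, x', hx', y, hy, -, h₁, h₂, h₃⟩ := exists_nontrivial_relation hn hD h hC h2
  have h3 : ({x, x', y} : Set (ZMod r)).encard = 3 :=
    Set.encard_eq_three.2 ⟨x, x', y, h₃, h₁, h₂, rfl⟩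
  rw [← h3]
  exact Set.encard_le_encard (by simp [Set.insert_subset_iff, hx, hx', hy])

open Classical in
/-- With only three colors `x`, `x'`, `y`, where `x + x' = 2 y`, there is no other crossing
relation, and the colors could be lifted to the integers `1`, `-1`, `0`. -/
theorem three_lt_encard (hn : 0 < n) (hD : D.IsDiagramOf (torusLink n))
    (h : TangleColoring r D.word [] [] C) (hC : C.Nontrivial)
    (h2 : ∀ z ∈ C, ∀ z' ∈ C, 2 * (z - z') = 0 → z = z')
    (h3 : ∀ z ∈ C, ∀ z' ∈ C, 3 * (z - z') = 0 → z = z') : 3 < C.encard := by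
  by_contra! hle
  obtain ⟨x, hx, x', hx', y, hy, hr, h₁, h₂, h₃⟩ := exists_nontrivial_relation hn hD h hC h2
  have hcard : ({x, x', y} : Set (ZMod r)).encard = 3 :=
    Set.encard_eq_three.2 ⟨x, x', y, h₃, h₁, h₂, rfl⟩
  have hCe : ({x, x', y} : Set (ZMod r)) = C :=
    (Set.toFinite _).eq_of_subset_of_encard_le (by simp [Set.insert_subset_iff, hx, hx', hy])
      (by rwa [hcard])
  have : Fact (1 < n + 1) := ⟨by omega⟩
  have key := relabel_const hD h (fun z => if z = y then 0 else if z = x then 1 else -1) ?_ hy hx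
  · simp [h₁] at key
  · -- A crossing with over-arc `x` or `x'` and two under-arcs of distinct colors would give 3-torsion.
    have hxy (h : 3 * (x - y) = 0) : False := h₁ (h3 x hx y hy h)
    have h2x (a) (ha : a ∈ C) (b) (hb : b ∈ C) (h : a + a - 2 * b = 0) : a = b :=
      h2 a ha b hb (by linear_combination h)
    have hxa (a b : ZMod r) (ha : a + b - 2 * b = 0) : a = b := by linear_combination ha
    have hxb (a b : ZMod r) (ha : b + a - 2 * b = 0) : a = b := by linear_combination ha
    have e₁ : ¬ x' + y - 2 * x = 0 := fun h => hxy (by linear_combination hr - h)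
    have e₂ : ¬ x + y - 2 * x' = 0 := fun h => hxy (by linear_combination 2 * hr + h)
    intro a ha b hb c hc hab
    by_cases hac : a = b
    · subst hac
      obtain rfl := h2x a ha c hc hab
      ring
    · have hac' : a ≠ c := fun e => by subst e; exact hac (hxb _ _ hab).symm
      have hbc' : b ≠ c := fun e => by subst e; exact hac (hxa _ _ hab)
      rw [← hCe] at ha hb hc
      simp only [Set.mem_insert_iff, Set.mem_singleton_iff] at ha hb hc
      rcases hc with rfl | rfl | rfl
      · grind
      · grind
      · grind

end LowerBound

/-! ### Isotopic tangles -/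

/-- `w` and `w'` are tangle diagrams with `m` strands at the top and `n` at the bottom, and
replacing one by the other in a link diagram does not change the link. -/
structure Isotopic (m n : ℕ) (w w' : List Slice) : Prop where
  fits_left : Fits w m n
  fits_right : Fits w' m n
  mk_eq : ∀ (A B : List Slice) (h : Fits (A ++ w ++ B) 0 0) (h' : Fits (A ++ w' ++ B) 0 0),
    Fits A 0 m → Fits B n 0 →
      Quot.mk Diagram.Move ⟨A ++ w ++ B, h⟩ = Quot.mk Diagram.Move ⟨A ++ w' ++ B, h'⟩

namespace Isotopic

variable {l m n p : ℕ} {w w' w'' : List Slice}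

theorem refl (h : Fits w m n) : Isotopic m n w w := ⟨h, h, fun _ _ _ _ _ _ => rfl⟩

theorem symm (h : Isotopic m n w w') : Isotopic m n w' w :=
  ⟨h.2, h.1, fun A B h₁ h₂ hA hB => (h.3 A B h₂ h₁ hA hB).symm⟩

theorem trans (h : Isotopic m n w w') (h' : Isotopic m n w' w'') : Isotopic m n w w'' :=
  ⟨h.1, h'.2, fun A B h₁ h₂ hA hB =>
    (h.3 A B h₁ (fits_append.2 ⟨n, fits_append.2 ⟨m, hA, h.2⟩, hB⟩) hA hB).trans
      (h'.3 A B _ h₂ hA hB)⟩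

theorem of_localMove (h : LocalMove w w') (hw : Fits w m n) (hw' : Fits w' m n) :
    Isotopic m n w w' :=
  ⟨hw, hw', fun A B _ _ _ _ => Quot.sound ⟨A, B, w, w', h, rfl, rfl⟩⟩

theorem congr (h : Isotopic m n w w') (A B : List Slice) (hA : Fits A l m) (hB : Fits B n p) :
    Isotopic l p (A ++ w ++ B) (A ++ w' ++ B) := by
  refine ⟨fits_append.2 ⟨n, fits_append.2 ⟨m, hA, h.1⟩, hB⟩,
    fits_append.2 ⟨n, fits_append.2 ⟨m, hA, h.2⟩, hB⟩, fun A' B' h₁ h₂ hA' hB' => ?_⟩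
  have := h.3 (A' ++ A) (B ++ B') (by simpa using h₁) (by simpa using h₂)
    (fits_append.2 ⟨l, hA', hA⟩) (fits_append.2 ⟨p, hB, hB'⟩)
  simpa using this

theorem cons (h : Isotopic m n w w') (s : Slice) (hs : Fits [s] l m) :
    Isotopic l n (s :: w) (s :: w') := by
  simpa using h.congr [s] [] hs rfl

theorem append_right (h : Isotopic m n w w') (B : List Slice) (hB : Fits B n p) :
    Isotopic m p (w ++ B) (w' ++ B) := by
  simpa using h.congr [] B rfl hB

end Isotopic

theorem fits_replicate_pos_left {i m : ℕ} (h : i + 2 ≤ m) (n : ℕ) :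
    Fits (List.replicate n ⟨.pos, i⟩) m m := by
  induction n with
  | zero => rfl
  | succ n ih =>
    refine ⟨h, ?_⟩
    rwa [show m - Piece.pos.ins + Piece.pos.outs = m by simp only [Piece.ins, Piece.outs]; omega]

/-- A twist of `k` crossings passes under a strand. -/
theorem isotopic_twist_under (k : ℕ) :
    Isotopic 6 6 (List.replicate k ⟨.pos, 1⟩ ++ [⟨.pos, 2⟩, ⟨.pos, 1⟩])
      ([⟨.pos, 2⟩, ⟨.pos, 1⟩] ++ List.replicate k ⟨.pos, 2⟩) := by
  induction k with
  | zero => exact .refl (by simp [Fits, Piece.ins, Piece.outs])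
  | succ k ih =>
    have h₁ := ih.cons ⟨.pos, 1⟩ (l := 6) (by simp [Fits, Piece.ins, Piece.outs])
    have h₂ : Isotopic 6 6 _ _ := .of_localMove (.reidemeister3 1)
      (by simp [Fits, Piece.ins, Piece.outs]) (by simp [Fits, Piece.ins, Piece.outs])
    exact h₁.trans (h₂.append_right _ (fits_replicate_pos_left (by omega) k))

theorem isotopic_twist_cup (k : ℕ) :
    Isotopic 6 4 (List.replicate k ⟨.pos, 2⟩ ++ [⟨.cup, 0⟩])
      (⟨.cup, 0⟩ :: List.replicate k ⟨.pos, 0⟩) := by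
  induction k with
  | zero => exact .refl (by simp [Fits, Piece.ins, Piece.outs])
  | succ k ih =>
    have h₁ := ih.cons ⟨.pos, 2⟩ (l := 6) (by simp [Fits, Piece.ins, Piece.outs])
    have h₂ : Isotopic 6 4 [⟨.pos, 2⟩, ⟨.cup, 0⟩] [⟨.cup, 0⟩, ⟨.pos, 0⟩] :=
      .of_localMove (.exchange .cup .pos 0 0)
        (by simp [Fits, Piece.ins, Piece.outs]) (by simp [Fits, Piece.ins, Piece.outs])
    exact h₁.trans (h₂.append_right _ (fits_replicate_pos_left (by omega) k))

/-- The twist of `k + 1` crossings, after the over-strand of its first crossing has been swung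
around the other `k` crossings: it passes down on the right of them, over the two strands below
them, up again on their left, and enters them from the top left. -/
def swungTwist (k : ℕ) : List Slice :=
  ⟨.cap, 0⟩ :: (List.replicate k ⟨.pos, 1⟩ ++ [⟨.pos, 2⟩, ⟨.pos, 1⟩, ⟨.cup, 0⟩])

/-- The two crossings under the swung strand move from below the twist to above it by moves of type
III; what is left of the detour on the left of the twist is a kink and a zigzag. -/
theorem isotopic_swungTwist (k : ℕ) :
    Isotopic 4 4 (swungTwist k) (List.replicate (k + 1) ⟨.pos, 0⟩) := by
  have hk := fits_replicate_pos_left (i := 0) (m := 4) (by omega) k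
  have h₁ : Isotopic 4 4 (swungTwist k)
      (⟨.cap, 0⟩ :: ⟨.pos, 2⟩ :: ⟨.pos, 1⟩ :: (List.replicate k ⟨.pos, 2⟩ ++ [⟨.cup, 0⟩])) := by
    simpa [swungTwist] using (isotopic_twist_under k).congr [⟨.cap, 0⟩] [⟨.cup, 0⟩] (l := 4)
      (p := 4) (by simp [Fits, Piece.ins, Piece.outs]) (by simp [Fits, Piece.ins, Piece.outs])
  have h₂ : Isotopic 4 4
      (⟨.cap, 0⟩ :: ⟨.pos, 2⟩ :: ⟨.pos, 1⟩ :: (List.replicate k ⟨.pos, 2⟩ ++ [⟨.cup, 0⟩]))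
      (⟨.cap, 0⟩ :: ⟨.pos, 2⟩ :: ⟨.pos, 1⟩ :: ⟨.cup, 0⟩ :: List.replicate k ⟨.pos, 0⟩) := by
    simpa using (isotopic_twist_cup k).congr [⟨.cap, 0⟩, ⟨.pos, 2⟩, ⟨.pos, 1⟩] [] (l := 4)
      (by simp [Fits, Piece.ins, Piece.outs]) rfl
  have h₃ : Isotopic 4 6 [⟨.cap, 0⟩, ⟨.pos, 2⟩] [⟨.pos, 0⟩, ⟨.cap, 0⟩] :=
    (Isotopic.of_localMove (.exchange .cap .pos 0 0)
      (by simp [Fits, Piece.ins, Piece.outs]) (by simp [Fits, Piece.ins, Piece.outs])).symm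
  have h₄ : Isotopic 4 6 [⟨.cap, 0⟩, ⟨.pos, 1⟩] [⟨.cap, 1⟩, ⟨.neg, 0⟩] :=
    .of_localMove (.slide_cap_pos 0)
      (by simp [Fits, Piece.ins, Piece.outs]) (by simp [Fits, Piece.ins, Piece.outs])
  have h₅ : Isotopic 6 4 [⟨.neg, 0⟩, ⟨.cup, 0⟩] [⟨.cup, 0⟩] :=
    .of_localMove (.reidemeister1_cup_neg 0)
      (by simp [Fits, Piece.ins, Piece.outs]) (by simp [Fits, Piece.ins, Piece.outs])
  have h₆ : Isotopic 4 4 [⟨.cap, 1⟩, ⟨.cup, 0⟩] [] :=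
    .of_localMove (.zigzag_right 0)
      (by simp [Fits, Piece.ins, Piece.outs]) (by simp [Fits])
  have g₃ := h₃.append_right (⟨.pos, 1⟩ :: ⟨.cup, 0⟩ :: List.replicate k ⟨.pos, 0⟩) (p := 4)
    (by simpa [Fits, Piece.ins, Piece.outs] using hk)
  have g₄ := h₄.congr [⟨.pos, 0⟩] (⟨.cup, 0⟩ :: List.replicate k ⟨.pos, 0⟩) (l := 4) (p := 4)
    (by simp [Fits, Piece.ins, Piece.outs]) (by simpa [Fits, Piece.ins, Piece.outs] using hk)
  have g₅ := h₅.congr [⟨.pos, 0⟩, ⟨.cap, 1⟩] (List.replicate k ⟨.pos, 0⟩) (l := 4)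
    (by simp [Fits, Piece.ins, Piece.outs]) hk
  have g₆ := h₆.congr [⟨.pos, 0⟩] (List.replicate k ⟨.pos, 0⟩) (l := 4)
    (by simp [Fits, Piece.ins, Piece.outs]) hk
  exact h₁.trans <| h₂.trans <| g₃.trans <| g₄.trans <| g₅.trans g₆

/-- A diagram of the twist of `2 k + 1` crossings, where `k = j + 1`: the crossings from the `k`-th
to the `2 k`-th one are replaced by a swung twist. -/
def economicalTwist (j : ℕ) : List Slice :=
  List.replicate j ⟨.pos, 0⟩ ++ swungTwist (j + 1) ++ [⟨.pos, 0⟩]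

theorem isotopic_economicalTwist (j : ℕ) :
    Isotopic 4 4 (economicalTwist j) (List.replicate (2 * j + 3) ⟨.pos, 0⟩) := by
  have h := (isotopic_swungTwist (j + 1)).congr (List.replicate j ⟨.pos, 0⟩) [⟨.pos, 0⟩]
    (fits_replicate_pos_left (by omega) j) (p := 4) (by simp [Fits, Piece.ins, Piece.outs])
  have e : List.replicate j (⟨.pos, 0⟩ : Slice) ++ List.replicate (j + 1 + 1) ⟨.pos, 0⟩ ++
      [⟨.pos, 0⟩] = List.replicate (2 * j + 3) ⟨.pos, 0⟩ := by
    rw [← List.replicate_one, ← List.replicate_add, ← List.replicate_add]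
    congr 1
    omega
  rwa [e] at h

theorem isotopic_flatten_replicate {m : ℕ} {w : List Slice} {s : Slice} {p : ℕ}
    (h : Isotopic m m w (List.replicate p s)) (q : ℕ) :
    Isotopic m m (List.replicate q w).flatten (List.replicate (p * q) s) := by
  induction q with
  | zero => exact .refl rfl
  | succ q ih =>
    rw [List.replicate_succ, List.flatten_cons, Nat.mul_succ, Nat.add_comm, List.replicate_add]
    have h₂ := ih.congr (List.replicate p s) [] h.2 rfl
    simp only [List.append_nil] at h₂
    exact (h.append_right _ ih.1).trans h₂

/-- The closure of a tangle on two strands, like that in `torusDiagram`.  The two strands on the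
right are the closing ones. -/
def closure (w : List Slice) : List Slice :=
  ⟨.cap, 0⟩ :: ⟨.cap, 1⟩ :: (w ++ [⟨.cup, 1⟩, ⟨.cup, 0⟩])

theorem fits_closure {w : List Slice} (h : Fits w 4 4) : Fits (closure w) 0 0 := by
  refine ⟨by decide, by decide, fits_append.2 ⟨4, h, ?_⟩⟩
  simp [Fits, Piece.ins, Piece.outs]

theorem isDiagramOf_torusLink {n : ℕ} {w : List Slice}
    (h : Isotopic 4 4 w (List.replicate n ⟨.pos, 0⟩)) :
    Diagram.IsDiagramOf ⟨closure w, fits_closure h.1⟩ (torusLink n) :=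
  h.3 [⟨.cap, 0⟩, ⟨.cap, 1⟩] [⟨.cup, 1⟩, ⟨.cup, 0⟩] (fits_closure h.1) (fits_closure h.2)
    (by simp [Fits, Piece.ins, Piece.outs]) (by simp [Fits, Piece.ins, Piece.outs])

/-! ### Economical colorings and upper bounds -/

/-- The tangle diagram `w` has a coloring by colors of the set `S` with the given colors at its
ends. -/
def ColorableIn {r : ℕ} (S : Set (ZMod r)) (w : List Slice) (u v : List (ZMod r)) : Prop :=
  ∃ C ⊆ S, TangleColoring r w u v C

section ColorableIn

variable {r : ℕ} {S : Set (ZMod r)} {w w' : List Slice} {u u' v : List (ZMod r)}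

theorem ColorableIn.nil (hu : ∀ x ∈ u, x ∈ S) : ColorableIn S [] u u := ⟨_, hu, rfl, rfl⟩

theorem ColorableIn.cons {s : Slice} (hu : ∀ x ∈ u, x ∈ S) (hs : SliceRule r s u u')
    (h : ColorableIn S w u' v) : ColorableIn S (s :: w) u v := by
  obtain ⟨C, hC, h⟩ := h
  exact ⟨_, Set.union_subset hu hC, _, _, hs, h, rfl⟩

theorem ColorableIn.append (h : ColorableIn S w u u') (h' : ColorableIn S w' u' v) :
    ColorableIn S (w ++ w') u v := by
  obtain ⟨C, hC, h⟩ := h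
  obtain ⟨C', hC', h'⟩ := h'
  exact ⟨_, Set.union_subset hC hC', tangleColoring_append.2 ⟨_, _, _, h, h', rfl⟩⟩

theorem ColorableIn.flatten_replicate (hu : ∀ x ∈ u, x ∈ S) (h : ColorableIn S w u u) (q : ℕ) :
    ColorableIn S (List.replicate q w).flatten u u := by
  induction q with
  | zero => exact .nil hu
  | succ q ih => exact h.append ih

theorem sliceRule_pos_append (a b : List (ZMod r)) {x y x' : ZMod r} (h : x + x' - 2 * y = 0) :
    SliceRule r ⟨.pos, a.length⟩ (a ++ x :: y :: b) (a ++ y :: x' :: b) :=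
  ⟨a, b, _, _, rfl, .pos x x' y h, by simp, by simp⟩

/-- A twist on the right of the strands colored by `a` is colored by an arithmetic progression of
difference `δ`. -/
theorem colorableIn_twist (a b : List (ZMod r)) (ha : ∀ z ∈ a, z ∈ S) (hb : ∀ z ∈ b, z ∈ S)
    (δ : ZMod r) (n : ℕ) (x : ZMod r) (h : ∀ i : ℕ, i ≤ n + 1 → x + i * δ ∈ S) :
    ColorableIn S (List.replicate n ⟨.pos, a.length⟩) (a ++ x :: (x + δ) :: b)
      (a ++ (x + n * δ) :: (x + (n + 1) * δ) :: b) := by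
  have h0 : x ∈ S := by simpa using h 0 (by omega)
  have h1 : x + δ ∈ S := by simpa using h 1 (by omega)
  have hu : ∀ z ∈ a ++ x :: (x + δ) :: b, z ∈ S := by
    simp only [List.mem_append, List.mem_cons]
    rintro z (hz | rfl | rfl | hz)
    exacts [ha z hz, h0, h1, hb z hz]
  induction n generalizing x with
  | zero => simpa using ColorableIn.nil hu
  | succ n ih =>
    have h' (i : ℕ) (hi : i ≤ n + 1) : x + δ + i * δ ∈ S := by
      have := h (i + 1) (by omega)
      rwa [show x + δ + i * δ = x + (i + 1 : ℕ) * δ by push_cast; ring]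
    have h2 : x + δ + δ ∈ S := by simpa using h' 1 (by omega)
    have := ih (x + δ) h' h1 h2 (by
      simp only [List.mem_append, List.mem_cons]
      rintro z (hz | rfl | rfl | hz)
      exacts [ha z hz, h1, h2, hb z hz])
    rw [show x + δ + n * δ = x + (n + 1 : ℕ) * δ by push_cast; ring,
      show x + δ + (n + 1) * δ = x + ((n + 1 : ℕ) + 1) * δ by push_cast; ring] at this
    exact .cons hu (sliceRule_pos_append a b (by ring)) this

/-- The economical twist is colored by `0, d, …, k d` and `2 k d = -d`, where `k = j + 1`. -/
theorem colorableIn_economicalTwist {d : ZMod r} (j : ℕ) (hd : ((2 * j + 3 : ℕ) : ZMod r) * d = 0)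
    (hS : ∀ i : ℕ, i ≤ j + 1 → (i : ZMod r) * d ∈ S) (hS' : -d ∈ S) :
    ColorableIn S (economicalTwist j) [0, d, d, 0] [0, d, d, 0] := by
  push_cast at hd
  have h0 : (0 : ZMod r) ∈ S := by simpa using hS 0 (by omega)
  have h1 : d ∈ S := by simpa using hS 1 (by omega)
  have hj : (j : ZMod r) * d ∈ S := hS j (by omega)
  have hk : ((j : ZMod r) + 1) * d ∈ S := by simpa using hS (j + 1) le_rfl
  have h₁ := colorableIn_twist (S := S) [] [d, 0] (by simp) (by simp [h0, h1]) d j 0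
    (fun i hi => by simpa using hS i hi)
  have h₂ := colorableIn_twist (S := S) [((j : ZMod r) + 1) * d] [((j : ZMod r) + 1) * d, d, 0]
    (by simpa) (by simp [h0, h1, hk]) (-d) (j + 1) (((j : ZMod r) + 1) * d) (fun i hi => by
      rcases hi.lt_or_eq with hi | rfl
      · have := hS (j + 1 - i) (by omega)
        rw [Nat.cast_sub (by omega)] at this
        convert this using 1
        push_cast
        ring
      · convert hS' using 1
        push_cast
        ring)
  have e₁ : ((j : ZMod r) + 1) * d + (j + 1 : ℕ) * -d = 0 := by push_cast; ring
  have e₂ : ((j : ZMod r) + 1) * d + ((j + 1 : ℕ) + 1) * -d = -d := by push_cast; ring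
  have e₃ : ((j : ZMod r) + 1) * d + -d = j * d := by ring
  rw [e₁, e₂, e₃] at h₂
  simp only [List.nil_append, List.cons_append, zero_add] at h₁ h₂
  have h₃ : ColorableIn S (swungTwist (j + 1)) [j * d, ((j : ZMod r) + 1) * d, d, 0]
      [-d, 0, d, 0] := by
    refine .cons (by simp [h0, h1, hk, hj]) ((sliceRule_cap _ _).2 ⟨((j : ZMod r) + 1) * d, rfl⟩)
      (h₂.append ?_)
    refine .cons (by simp [h0, h1, hk, hS'])
      (sliceRule_pos_append [((j : ZMod r) + 1) * d, 0] [d, 0] (x' := 0) ?_) ?_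
    · linear_combination -hd
    refine .cons (by simp [h0, h1, hk])
      (sliceRule_pos_append [((j : ZMod r) + 1) * d] [0, d, 0] (x' := -d) ?_) ?_
    · linear_combination -hd
    exact .cons (by simp [h0, h1, hk, hS']) ((sliceRule_cup _ _).2 ⟨_, rfl⟩)
      (.nil (by simp [h0, h1, hS']))
  exact (h₁.append h₃).append (.cons (by simp [h0, h1, hS'])
    (sliceRule_pos_append [] [d, 0] (x := -d) (by ring)) (.nil (by simp [h0, h1])))

end ColorableIn

theorem mincol_le {r : ℕ} {K : Link} {D : Diagram} (hD : D.IsDiagramOf K) {C : Set (ZMod r)}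
    (h : TangleColoring r D.word [] [] C) (hC : C.Nontrivial) : mincol r K ≤ C.encard := by
  obtain ⟨c, rfl⟩ := exists_coloring_iff.2 h
  exact (iInf₂_le D hD).trans (iInf₂_le c (Set.not_subsingleton_iff.2 hC))

theorem le_mincol {r : ℕ} {K : Link} {N : ℕ∞}
    (h : ∀ D : Diagram, D.IsDiagramOf K → ∀ C : Set (ZMod r), TangleColoring r D.word [] [] C →
      C.Nontrivial → N ≤ C.encard) : N ≤ mincol r K :=
  le_iInf₂ fun D hD => le_iInf₂ fun c hc =>
    h D hD c.colors (exists_coloring_iff.1 ⟨c, rfl⟩) (Set.not_subsingleton_iff.1 hc)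

/-- A coloring of a tangle isotopic to the twist, with the colors `0`, `d` on its two strands, is
closed up to a coloring of the link. -/
theorem mincol_torusLink_le {r n : ℕ} {w : List Slice}
    (hw : Isotopic 4 4 w (List.replicate n ⟨.pos, 0⟩)) {S : Set (ZMod r)} {d : ZMod r}
    (hd : d ≠ 0) (h : ColorableIn S w [0, d, d, 0] [0, d, d, 0]) :
    mincol r (torusLink n) ≤ S.encard := by
  obtain ⟨C₁, hC₁, h₁⟩ := h
  have h0 : 0 ∈ S := hC₁ (h₁.top_subset (by simp))
  have h1 : d ∈ S := hC₁ (h₁.top_subset (by simp))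
  have h : TangleColoring r (closure w) [] [] _ :=
    ⟨_, _, (sliceRule_cap _ _).2 ⟨0, rfl⟩, ⟨_, _, (sliceRule_succ _ _ _ _).2
      ⟨0, [0], [d, d, 0], rfl, rfl, (sliceRule_cap _ _).2 ⟨d, rfl⟩⟩,
      tangleColoring_append.2 ⟨_, C₁, _, h₁, ⟨_, _, (sliceRule_succ _ _ _ _).2
        ⟨0, [d, d, 0], [0], rfl, rfl, (sliceRule_cup _ _).2 ⟨d, rfl⟩⟩,
        ⟨_, _, (sliceRule_cup _ _).2 ⟨0, rfl⟩, ⟨rfl, rfl⟩, rfl⟩, rfl⟩, rfl⟩, rfl⟩, rfl⟩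
  refine (mincol_le (isDiagramOf_torusLink hw) h ⟨0, ?_, d, ?_, hd.symm⟩).trans
    (Set.encard_le_encard ?_)
  · simp
  · exact .inr (.inr (.inl (h₁.top_subset (by simp))))
  · simp [Set.subset_def, h0, h1, or_imp, forall_and]
    exact fun x hx => hC₁ hx

theorem encard_image_range_le {α : Type*} (f : ℕ → α) (N : ℕ) :
    (f '' (Finset.range N : Set ℕ)).encard ≤ N :=
  (Set.encard_image_le _ _).trans (by rw [Set.encard_coe_eq_coe_finsetCard, Finset.card_range])

/-- The standard diagram of `T(2, n)` is colored by the multiples of `d`. -/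
theorem mincol_torusLink_le_of_dvd {r n p : ℕ} (hp : 0 < p) (hn : p ∣ n) {d : ZMod r}
    (hd : d ≠ 0) (hpd : (p : ZMod r) * d = 0) : mincol r (torusLink n) ≤ p := by
  obtain ⟨S, hSp, hS⟩ : ∃ S : Set (ZMod r), S.encard ≤ p ∧ ∀ i : ℕ, (i : ZMod r) * d ∈ S := by
    refine ⟨_, encard_image_range_le (fun i : ℕ => (i : ZMod r) * d) p, fun i =>
      ⟨i % p, by simpa using Nat.mod_lt i hp, ?_⟩⟩
    conv_rhs => rw [← Nat.mod_add_div i p]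
    push_cast
    linear_combination -((i / p : ℕ) : ZMod r) * hpd
  refine (mincol_torusLink_le (.refl (fits_replicate_pos_left (by omega) n)) hd ?_).trans hSp
  have h0 := hS 0
  have h1 := hS 1
  simp only [Nat.cast_zero, zero_mul, Nat.cast_one, one_mul] at h0 h1
  have := colorableIn_twist (S := S) [] [d, 0] (by simp) (by simp [h0, h1]) d n 0
    (fun i _ => by simpa using hS i)
  obtain ⟨q, rfl⟩ := hn
  have e : (p : ZMod r) * q * d = 0 := by linear_combination q * hpd
  simpa [add_mul, e] using this

/-- The `n` crossings are cut into groups of `2 k + 1`, and each group is replaced by an economical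
twist. -/
theorem mincol_torusLink_le_add_two {r n k : ℕ} (hk : 1 ≤ k) (hn : 2 * k + 1 ∣ n) {d : ZMod r}
    (hd : d ≠ 0) (hkd : ((2 * k + 1 : ℕ) : ZMod r) * d = 0) :
    mincol r (torusLink n) ≤ k + 2 := by
  obtain ⟨j, rfl⟩ := Nat.exists_eq_add_of_le' hk
  obtain ⟨q, rfl⟩ := hn
  obtain ⟨S, hSk, hS, hS'⟩ : ∃ S : Set (ZMod r), S.encard ≤ (j + 1 + 2 : ℕ) ∧
      (∀ i : ℕ, i ≤ j + 1 → (i : ZMod r) * d ∈ S) ∧ -d ∈ S :=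
    ⟨_, encard_image_range_le (fun i => if i ≤ j + 1 then (i : ZMod r) * d else -d) (j + 1 + 2),
      fun i hi => ⟨i, by simp; omega, by simp [hi]⟩, ⟨j + 2, by simp, by simp⟩⟩
  have h0 := hS 0 (by omega)
  have h1 := hS 1 (by omega)
  simp only [Nat.cast_zero, zero_mul, Nat.cast_one, one_mul] at h0 h1
  have hc := (colorableIn_economicalTwist j hkd hS hS').flatten_replicate (by simp [h0, h1]) q
  exact (mincol_torusLink_le (isotopic_flatten_replicate (isotopic_economicalTwist j) q) hd
    hc).trans (by exact_mod_cast hSk)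

/-! ### The least common prime divisor -/

theorem leastCommonPrime_spec {n r : ℕ} (h : 1 < Nat.gcd n r) :
    (leastCommonPrime n r).Prime ∧ leastCommonPrime n r ∣ n ∧ leastCommonPrime n r ∣ r ∧
      ∀ q : ℕ, q.Prime → q ∣ n → q ∣ r → leastCommonPrime n r ≤ q := by
  rw [leastCommonPrime, if_neg h.ne']
  have hne : {p : ℕ | p.Prime ∧ p ∣ n ∧ p ∣ r}.Nonempty :=
    ⟨_, Nat.minFac_prime h.ne', (Nat.minFac_dvd _).trans (Nat.gcd_dvd_left n r),
      (Nat.minFac_dvd _).trans (Nat.gcd_dvd_right n r)⟩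
  obtain ⟨h₁, h₂, h₃⟩ := Nat.sInf_mem hne
  exact ⟨h₁, h₂, h₃, fun q hq hqn hqr => Nat.sInf_le ⟨hq, hqn, hqr⟩⟩

/-- The `n`-torsion of `ℤ/r` has no torsion below the least common prime divisor. -/
theorem eq_zero_of_mul_eq_zero {n r j : ℕ} (h : 1 < Nat.gcd n r) (hj : 0 < j)
    (hjp : j < leastCommonPrime n r) {δ : ZMod r} (hn : (n : ZMod r) * δ = 0)
    (hjδ : (j : ZMod r) * δ = 0) : δ = 0 := by
  by_contra hδ
  have h₁ : addOrderOf δ ≠ 1 := fun h => hδ (AddMonoid.addOrderOf_eq_one_iff.1 h)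
  have key (m : ℕ) (hm : (m : ZMod r) * δ = 0) : (addOrderOf δ).minFac ∣ m :=
    (Nat.minFac_dvd _).trans (addOrderOf_dvd_of_nsmul_eq_zero (by rwa [nsmul_eq_mul]))
  have hle := (leastCommonPrime_spec h).2.2.2 _ (Nat.minFac_prime h₁) (key n hn)
    (key r (by simp))
  have := Nat.le_of_dvd hj (key j hjδ)
  omega

theorem exists_ne_zero_mul_eq_zero {p r : ℕ} (hr : 0 < r) (hp : 1 < p) (h : p ∣ r) :
    ∃ d : ZMod r, d ≠ 0 ∧ (p : ZMod r) * d = 0 := by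
  obtain ⟨s, rfl⟩ := h
  have hs : 0 < s := Nat.pos_of_mul_pos_left hr
  refine ⟨(s : ZMod (p * s)), fun h => ?_, by exact_mod_cast ZMod.natCast_self (p * s)⟩
  rw [ZMod.natCast_eq_zero_iff] at h
  have := Nat.le_of_dvd hs h
  nlinarith

theorem two_le_mincol (r : ℕ) (K : Link) : 2 ≤ mincol r K :=
  le_mincol fun _ _ C _ hC => by
    have := Order.add_one_le_of_lt (Set.one_lt_encard_iff_nontrivial.2 hC)
    rwa [one_add_one_eq_two] at this

theorem three_le_mincol {n r : ℕ} (hn : 0 < n) (h : 1 < Nat.gcd n r)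
    (hp : 2 < leastCommonPrime n r) : 3 ≤ mincol r (torusLink n) :=
  le_mincol fun _ hD _ hC hC' => three_le_encard hn hD hC hC' fun _ hz _ hz' h2 =>
    sub_eq_zero.1 (eq_zero_of_mul_eq_zero h two_pos hp (mul_sub_eq_zero hD hC hz hz')
      (by exact_mod_cast h2))

theorem four_le_mincol {n r : ℕ} (hn : 0 < n) (h : 1 < Nat.gcd n r)
    (hp : 3 < leastCommonPrime n r) : 4 ≤ mincol r (torusLink n) :=
  le_mincol fun _ hD _ hC hC' => by
    have key := three_lt_encard hn hD hC hC'
      (fun _ hz _ hz' h2 => sub_eq_zero.1 (eq_zero_of_mul_eq_zero h two_pos (by omega)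
        (mul_sub_eq_zero hD hC hz hz') (by exact_mod_cast h2)))
      (fun _ hz _ hz' h3 => sub_eq_zero.1 (eq_zero_of_mul_eq_zero h three_pos hp
        (mul_sub_eq_zero hD hC hz hz') (by exact_mod_cast h3)))
    have := Order.add_one_le_of_lt key
    rwa [three_add_one_eq_four] at this

end FoxColoring

theorem mainTheorem1 (n r : ℕ) (hn : 0 < n) (hr : 0 < r) (hnr : 1 < Nat.gcd n r) :
    (FoxColoring.leastCommonPrime n r = 2 ∨ FoxColoring.leastCommonPrime n r = 3 →
      FoxColoring.mincol r (FoxColoring.torusLink n) =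
        (FoxColoring.leastCommonPrime n r : ℕ∞)) ∧
    (FoxColoring.leastCommonPrime n r = 5 →
      FoxColoring.mincol r (FoxColoring.torusLink n) = 4) ∧
    (∀ k : ℕ, 2 < k → FoxColoring.leastCommonPrime n r = 2 * k + 1 →
      3 < FoxColoring.mincol r (FoxColoring.torusLink n) ∧
      FoxColoring.mincol r (FoxColoring.torusLink n) ≤ (k : ℕ∞) + 2) := by
  obtain ⟨hp, hpn, hpr, -⟩ := FoxColoring.leastCommonPrime_spec hnr
  obtain ⟨d, hd, hpd⟩ := FoxColoring.exists_ne_zero_mul_eq_zero hr hp.one_lt hpr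
  refine ⟨fun h => ?_, fun h => ?_, fun k hk h => ?_⟩
  · refine le_antisymm (FoxColoring.mincol_torusLink_le_of_dvd hp.pos hpn hd hpd) ?_
    rcases h with h | h
    · rw [h]
      exact FoxColoring.two_le_mincol r _
    · have := FoxColoring.three_le_mincol hn hnr (by omega)
      rw [h]
      exact this
  · have h4 := FoxColoring.four_le_mincol hn hnr (by omega)
    rw [h] at hpn hpd
    have := FoxColoring.mincol_torusLink_le_add_two (k := 2) (by omega) hpn hd hpd
    exact le_antisymm (this.trans (by norm_num)) h4
  · have h4 := FoxColoring.four_le_mincol hn hnr (by omega)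
    rw [h] at hpn hpd
    exact ⟨lt_of_lt_of_le (by norm_num) h4,
      FoxColoring.mincol_torusLink_le_add_two (by omega) hpn hd hpd⟩
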